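/- Let $(\Sigma,h)$ be a smooth Riemannian three-manifold and $\rho:\Sigma\to\mathbb R$ a smooth function whose gradient vanishes at most at isolated regular origins (points to which the level sets of $\rho$ shrink). Assume that, away from these points, $\Sigma$ is smoothly foliated by a one-parameter family of two-spheres $\mathscr S_\rho$, the $\rho=\mathrm{const}$ level surfaces, and that a flow has been chosen, i.e. a vector field $\rho^i=(\partial_\rho)^i$ with $\rho^i\partial_i\rho=1$ whose integral curves meet each leaf exactly once, so that it identifies the leaves smoothly with a fixed two-sphere. Let $\widehat n^i$ be the unit normal in the direction of the gradient of $\rho$, $\widehat N=(\widehat n^i\partial_i\rho)^{-1}$ the lapse, $\widehat K{}^l{}_l=D_i\widehat n^i$ the mean curvature of the leaves, $\widehat R$ and $\widehat{\boldsymbol\epsilon}$ the scalar curvature and the area form of the metric induced on a leaf, $\mathscr A_\rho=\int_{\mathscr S_\rho}\widehat{\boldsymbol\epsilon}$ its area, and $\widetilde{\boldsymbol\epsilon}=(\mathscr A_\rho/4\pi)^{-1}\,\widehat{\boldsymbol\epsilon}$. Let $$M_{\mathcal G}(\rho)=\frac{\mathscr A_\rho^{1/2}}{64\pi^{3/2}}\int_{\mathscr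 S_\rho}\big[2\widehat R-(\widehat K{}^l{}_l)^2\big]\,\widehat{\boldsymbol\epsilon}$$ be the Geroch mass of $\mathscr S_\rho$. Assume the shift condition $$\widehat N\widehat K{}^l{}_l=\overline{\widehat N\widehat K{}^l{}_l}=\partial_\rho(\log\mathscr A_\rho)$$ on all leaves, where the bar denotes the average over the leaf with respect to $\widehat{\boldsymbol\epsilon}$. Then, on each leaf $\mathscr S_\rho$, $\int_{\mathscr S_\rho}\widetilde{\boldsymbol\epsilon}=4\pi$ and $$M_{\mathcal G}(\rho)=\frac{\mathscr A_\rho^{1/2}}{64\pi^{3/2}}\Big[16\pi-\int_{\mathscr S_\rho}\big[\partial_\rho(\log\mathscr A_\rho)\big]^2\widehat N^{-2}\,\widehat{\boldsymbol\epsilon}\Big]=\frac1{8\pi}\Big(\frac{\mathscr A_\rho}{4\pi}\Big)^{1/2}\int_{\mathscr S_\rho}\Big[1-\Big(\partial_\rho\Big(\frac{\mathscr A_\rho}{4\pi}\Big)^{1/2}\Big)^2\widehat N^{-2}\Big]\,\widetilde{\boldsymbol\epsilon}\,,$$ and consequently $M_{\mathcal G}(\rho)\ge 0$ whenever $$\int_{\mathscr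 S_\rho}\Big[1-\Big(\partial_\rho\Big(\frac{\mathscr A_\rho}{4\pi}\Big)^{1/2}\Big)^2\widehat N^{-2}\Big]\,\widetilde{\boldsymbol\epsilon}\ \ge\ 0 .$$ -/

import Mathlib

open scoped Manifold ContDiff Topology

noncomputable section

namespace Geroch

/-- Coordinate space `ℝⁿ`. -/
abbrev Coord (n : ℕ) : Type := EuclideanSpace ℝ (Fin n)

/-- The unit two-sphere in `ℝ³`, with Mathlib's smooth structure. -/
abbrev Sphere2 : Type := Metric.sphere (0 : EuclideanSpace ℝ (Fin 3)) 1

instance factFinrankThree : Fact (Module.finrank ℝ (EuclideanSpace ℝ (Fin 3)) = 2 + 1) :=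
  ⟨by simp⟩

/-! ### Riemannian geometry in local coordinates

Below, `G : Coord n → Matrix (Fin n) (Fin n) ℝ` stands for the matrix `G_ij(y)` of coefficients of
a Riemannian metric in a local coordinate system. -/

section Coordinates

variable {n : ℕ}

/-- The partial derivative `∂_i f` at `y`. -/
def pd (i : Fin n) (f : Coord n → ℝ) (y : Coord n) : ℝ :=
  fderiv ℝ f y (EuclideanSpace.single i 1)

/-- The Christoffel symbols
`Γ^k_ij = ½ Σ_l G^{kl} (∂_i G_jl + ∂_j G_il - ∂_l G_ij)`. -/
def christoffel (G : Coord n → Matrix (Fin n) (Fin n) ℝ) (k i j : Fin n) (y : Coord n) : ℝ :=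
  (1 / 2) * ∑ l, (G y)⁻¹ k l *
    (pd i (fun z => G z j l) y + pd j (fun z => G z i l) y - pd l (fun z => G z i j) y)

/-- The Ricci tensor
`R_ij = Σ_k (∂_k Γ^k_ij - ∂_j Γ^k_ik) + Σ_kl (Γ^k_kl Γ^l_ij - Γ^k_jl Γ^l_ik)`. -/
def ricci (G : Coord n → Matrix (Fin n) (Fin n) ℝ) (i j : Fin n) (y : Coord n) : ℝ :=
  (∑ k, (pd k (christoffel G k i j) y - pd j (christoffel G k i k) y)) +
    ∑ k, ∑ l, (christoffel G k k l y * christoffel G l i j y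
      - christoffel G k j l y * christoffel G l i k y)

/-- The scalar curvature `R = Σ_ij G^{ij} R_ij`. -/
def scalarCurv (G : Coord n → Matrix (Fin n) (Fin n) ℝ) (y : Coord n) : ℝ :=
  ∑ i, ∑ j, (G y)⁻¹ i j * ricci G i j y

/-- The unit form normal to the level sets of `f`: `n_i = ∂_i f / (G^{kl} ∂_k f ∂_l f)^{1/2}`. -/
def normalForm (G : Coord n → Matrix (Fin n) (Fin n) ℝ) (f : Coord n → ℝ) (i : Fin n)
    (y : Coord n) : ℝ :=
  pd i f y / √(∑ k, ∑ l, (G y)⁻¹ k l * pd k f y * pd l f y)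

/-- The unit normal vector field `n^i = Σ_j G^{ij} n_j`. -/
def normalVec (G : Coord n → Matrix (Fin n) (Fin n) ℝ) (f : Coord n → ℝ) (i : Fin n)
    (y : Coord n) : ℝ :=
  ∑ j, (G y)⁻¹ i j * normalForm G f j y

/-- The lapse `N = (n^i ∂_i f)⁻¹`. -/
def lapseCoord (G : Coord n → Matrix (Fin n) (Fin n) ℝ) (f : Coord n → ℝ) (y : Coord n) : ℝ :=
  (∑ i, normalVec G f i y * pd i f y)⁻¹

/-- The extrinsic curvature `K_ij = Σ_l γ^l_i D_l n_j` of the level sets of `f`, where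
`γ^l_i = δ^l_i - n^l n_i` and `D_l n_j = ∂_l n_j - Σ_k Γ^k_lj n_k`. -/
def extrinsicCurv (G : Coord n → Matrix (Fin n) (Fin n) ℝ) (f : Coord n → ℝ) (i j : Fin n)
    (y : Coord n) : ℝ :=
  ∑ l, ((if l = i then 1 else 0) - normalVec G f l y * normalForm G f i y) *
    (pd l (normalForm G f j) y - ∑ k, christoffel G k l j y * normalForm G f k y)

/-- The mean curvature `K^l_l = Σ_ij γ^{ij} K_ij`, `γ^{ij} = G^{ij} - n^i n^j`, of the level sets
of `f`. -/
def meanCurvCoord (G : Coord n → Matrix (Fin n) (Fin n) ℝ) (f : Coord n → ℝ) (y : Coord n) : ℝ :=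
  ∑ i, ∑ j, ((G y)⁻¹ i j - normalVec G f i y * normalVec G f j y) * extrinsicCurv G f i j y

end Coordinates

section Manifold

variable {M : Type*} [TopologicalSpace M] [ChartedSpace (Coord 3) M] [IsManifold (𝓡 3) ∞ M]

variable (M) in
/-- Smooth Riemannian metrics on the three-manifold `M`. -/
abbrev Metric3 : Type _ :=
  Bundle.ContMDiffRiemannianMetric (𝓡 3) ∞ (EuclideanSpace ℝ (Fin 3))
    (fun p : M => TangentSpace (𝓡 3) p)

/-- The coefficients `h(∂_i ψ, ∂_j ψ)` of the pullback of `h` under `ψ : ℝⁿ → M`. For `ψ` the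
inverse of a chart these are the coefficients of `h` in that chart; for `ψ` a local parametrization
of a submanifold, these are the coefficients of the induced metric. -/
def metricCoeff {n : ℕ} (h : Metric3 M) (ψ : Coord n → M) (y : Coord n) :
    Matrix (Fin n) (Fin n) ℝ :=
  Matrix.of fun i j =>
    h.inner (ψ y) (mfderiv (𝓡 n) (𝓡 3) ψ y (EuclideanSpace.single i (1 : ℝ)))
      (mfderiv (𝓡 n) (𝓡 3) ψ y (EuclideanSpace.single j (1 : ℝ)))

/-- The lapse of the foliation by level sets of `ρ`, evaluated at `p` in the chart at `p`. -/
def lapse (h : Metric3 M) (ρ : M → ℝ) (p : M) : ℝ :=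
  lapseCoord (metricCoeff h (chartAt (Coord 3) p).symm) (ρ ∘ (chartAt (Coord 3) p).symm)
    (chartAt (Coord 3) p p)

/-- The mean curvature at `p` of the level set of `ρ` through `p`, in `(M, h)`, evaluated in the
chart at `p`. -/
def meanCurv (h : Metric3 M) (ρ : M → ℝ) (p : M) : ℝ :=
  meanCurvCoord (metricCoeff h (chartAt (Coord 3) p).symm) (ρ ∘ (chartAt (Coord 3) p).symm)
    (chartAt (Coord 3) p p)

/-- A foliation of `M` by two-spheres `S_r`, `r ∈ params`, that are level surfaces of the smooth
function `ρ` whose gradient vanishes at most at isolated regular origins, together with a flow.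
The map `leaf r` identifies the standard two-sphere with `S_r = ρ⁻¹{r}`. The curves
`r ↦ leaf r x` are the integral curves of the flow `ρ^i = (∂_ρ)^i`: they meet each leaf exactly
once, and `ρ^i ∂_i ρ = 1` because `ρ (leaf r x) = r`. -/
structure SphereFoliation (ρ : M → ℝ) where
  /-- The set of values of `ρ` on the leaves. -/
  params : Set ℝ
  isOpen_params : IsOpen params
  /-- The parametrized leaves. -/
  leaf : ℝ → Sphere2 → M
  smooth_ρ : ContMDiff (𝓡 3) 𝓘(ℝ, ℝ) ∞ ρ
  smooth_leaf : ContMDiffOn (𝓘(ℝ, ℝ).prod (𝓡 2)) (𝓡 3) ∞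
    (fun q : ℝ × Sphere2 => leaf q.1 q.2) (params ×ˢ Set.univ)
  injective_leaf : ∀ r ∈ params, Function.Injective (leaf r)
  immersion_leaf : ∀ r ∈ params, ∀ x : Sphere2,
    Function.Injective (mfderiv (𝓡 2) (𝓡 3) (leaf r) x)
  range_leaf : ∀ r ∈ params, Set.range (leaf r) = ρ ⁻¹' {r}
  /-- The leaves cover `M` up to the critical points of `ρ`. -/
  cover : ∀ p : M, mfderiv (𝓡 3) 𝓘(ℝ, ℝ) ρ p ≠ 0 → ρ p ∈ params
  /-- The critical points of `ρ` are isolated. -/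
  isolated : ∀ p : M, mfderiv (𝓡 3) 𝓘(ℝ, ℝ) ρ p = 0 →
    ∀ᶠ q in 𝓝[≠] p, mfderiv (𝓡 3) 𝓘(ℝ, ℝ) ρ q ≠ 0
  /-- The critical points `p` of `ρ` are origins, that is, the leaves `S_r` shrink to `p` as
  `r → ρ p`. They are regular, as `M` is a smooth manifold with a smooth metric at `p`. -/
  origin : ∀ p : M, mfderiv (𝓡 3) 𝓘(ℝ, ℝ) ρ p = 0 →
    ∀ U ∈ 𝓝 p, ∀ᶠ r in 𝓝 (ρ p), r ∈ params → Set.range (leaf r) ⊆ U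

/-- The north pole of the two-sphere. -/
def northPole : Sphere2 := ⟨EuclideanSpace.single 2 1, by simp⟩

/-- The inverse of the stereographic projection from the point `v` of the two-sphere. -/
def stereoInv (v : Sphere2) : Coord 2 → Sphere2 := (stereographic' 2 v).symm

namespace SphereFoliation

variable {ρ : M → ℝ} (F : SphereFoliation ρ) (h : Metric3 M)

/-- The coefficients of the metric induced on the leaf `S_r`, in the stereographic coordinates
from `v`. -/
def leafMetric (r : ℝ) (v : Sphere2) : Coord 2 → Matrix (Fin 2) (Fin 2) ℝ :=
  metricCoeff h (F.leaf r ∘ stereoInv v)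

/-- The area form of the metric induced on `S_r`, as a measure on the two-sphere. It is computed in
the stereographic coordinates from the north pole, which omit a single point of the sphere. -/
def area (r : ℝ) : MeasureTheory.Measure Sphere2 :=
  (MeasureTheory.volume.withDensity
    (fun y : Coord 2 => ENNReal.ofReal √(F.leafMetric h r northPole y).det)).map
    (stereoInv northPole)

/-- The total area of `S_r`. -/
def totalArea (r : ℝ) : ℝ := (F.area h r).real Set.univ

/-- The area form of `S_r` divided by `(total area) / 4π`. -/
def normalizedArea (r : ℝ) : MeasureTheory.Measure Sphere2 :=
  ENNReal.ofReal ((F.totalArea h r / (4 * Real.pi))⁻¹) • F.area h r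

open Classical in
/-- The scalar curvature of the metric induced on `S_r`, at the point `leaf r x`. It does not depend
on the coordinates around `x` in which it is computed; the stereographic coordinates from the north
pole are used, except at the north pole itself. -/
def leafScalarCurv (r : ℝ) (x : Sphere2) : ℝ :=
  let v : Sphere2 := if x = northPole then -northPole else northPole
  scalarCurv (F.leafMetric h r v) (stereographic' 2 v x)

/-- The Geroch mass of `S_r`. -/
def gerochMass (r : ℝ) : ℝ :=
  √(F.totalArea h r) / (64 * Real.pi ^ (3 / 2 : ℝ)) *
    ∫ x, (2 * F.leafScalarCurv h r x - meanCurv h ρ (F.leaf r x) ^ 2) ∂(F.area h r)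

/-- The average of the function `u : M → ℝ` over `S_r`. -/
def leafAverage (u : M → ℝ) (r : ℝ) : ℝ :=
  (∫ x, u (F.leaf r x) ∂(F.area h r)) / ∫ _, (1 : ℝ) ∂(F.area h r)

/-- The shift condition: throughout the foliated region, the product of lapse and mean curvature
equals its average over the leaf, and this is the derivative of the logarithm of the area. -/
def ShiftCondition : Prop :=
  ∀ r ∈ F.params, ∀ x : Sphere2,
    lapse h ρ (F.leaf r x) * meanCurv h ρ (F.leaf r x)
        = F.leafAverage h (fun p => lapse h ρ p * meanCurv h ρ p) r ∧
      F.leafAverage h (fun p => lapse h ρ p * meanCurv h ρ p) r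
        = deriv (fun s => Real.log (F.totalArea h s)) r

/-- The integral over `S_r` of `1 - (∂_ρ (𝒜/4π)^{1/2})² N⁻²` with respect to the normalized area
form. -/
def lapseAreaIntegral (r : ℝ) : ℝ :=
  ∫ x, (1 - deriv (fun s => √(F.totalArea h s / (4 * Real.pi))) r ^ 2 *
    (lapse h ρ (F.leaf r x) ^ 2)⁻¹) ∂(F.normalizedArea h r)

end SphereFoliation

end Manifold

end Geroch

end

/-!
The three formulas are algebra once two facts are known about a leaf `S_r`: the integral of its
scalar curvature is `8π`, and the functions to be integrated are integrable. The shift condition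
gives `K = ∂_ρ (log 𝒜) / N`, as the lapse `N` is nonzero: a leaf contains no critical point of
`ρ`, because `ρ` increases with unit speed along the flow. The remaining integrand `N⁻² = |dρ|²` is
continuous on the leaf. Differentiability of the area is not needed: if `𝒜` is not differentiable
at `r`, then neither are `log 𝒜` and `√𝒜`, and the two derivatives agree, being both zero.

The Gauss–Bonnet theorem for a metric `G` on the sphere is proved in the stereographic coordinates
from the north pole, that is, on the plane. The scalar curvature density is the curl of the
connection form of an orthonormal frame (`IsPlaneMetric.scalarCurv_mul_sqrt_det`), and the frame
`G^{-1/2}` is chosen because it behaves well under conformal changes of coordinates: the inversion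
`z ↦ z / |z|²`, which relates the coordinates from the two poles, carries it to the frame of the
same kind in the other coordinates, composed with the reflection in the line orthogonal to `z`. This
reflection does not depend on the metric. The connection form (`connForm`) of `G` is therefore
`4 dθ` minus the pullback of the connection form of the same metric in the coordinates from the
south pole (`IsInversionPullback.connForm_eq`). The latter is smooth at the origin, so that its
pullback is `O(|z|⁻²)` at infinity, and the curl of the pullback is `O(|z|⁻⁴)`, hence integrable.

Up to `O(|z|⁻²)`, the connection form thus agrees at infinity with the smooth form
`4 (x dy - y dx) / (1 + |z|²)`, whatever the metric. A cutoff argument shows that the integral of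
the curl of a form of size `O(|z|⁻²)` vanishes (`integral_curl_eq_zero`), so the total scalar
curvature is `∫ 8 / (1 + |z|²)² = 8π`.
-/

noncomputable section

namespace Geroch

open MeasureTheory Filter

/-! ### Partial derivatives -/

section PartialDerivatives

variable {n : ℕ} {f g : Coord n → ℝ} {y : Coord n} (i j : Fin n)

theorem pd_add (hf : DifferentiableAt ℝ f y) (hg : DifferentiableAt ℝ g y) :
    pd i (fun z => f z + g z) y = pd i f y + pd i g y := by
  simp [pd, fderiv_fun_add hf hg]

theorem pd_sub (hf : DifferentiableAt ℝ f y) (hg : DifferentiableAt ℝ g y) :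
    pd i (fun z => f z - g z) y = pd i f y - pd i g y := by
  simp [pd, fderiv_fun_sub hf hg]

theorem pd_neg : pd i (fun z => -f z) y = -pd i f y := by
  simp [pd, fderiv_fun_neg]

theorem pd_const (c : ℝ) : pd i (fun _ => c) y = 0 := by
  simp [pd]

theorem pd_mul (hf : DifferentiableAt ℝ f y) (hg : DifferentiableAt ℝ g y) :
    pd i (fun z => f z * g z) y = pd i f y * g y + f y * pd i g y := by
  simp [pd, fderiv_fun_mul hf hg]; ring

theorem pd_const_mul (c : ℝ) (hf : DifferentiableAt ℝ f y) :
    pd i (fun z => c * f z) y = c * pd i f y := by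
  simp [pd_mul i (differentiableAt_const c) hf, pd_const]

theorem pd_inv (hf : DifferentiableAt ℝ f y) (h0 : f y ≠ 0) :
    pd i (fun z => (f z)⁻¹) y = -pd i f y / f y ^ 2 := by
  have := (hasDerivAt_inv h0).comp_hasFDerivAt y hf.hasFDerivAt
  have h2 : fderiv ℝ (fun z => (f z)⁻¹) y = _ := this.fderiv
  simp [pd, h2]; ring

theorem pd_div (hf : DifferentiableAt ℝ f y) (hg : DifferentiableAt ℝ g y) (h0 : g y ≠ 0) :
    pd i (fun z => f z / g z) y = (pd i f y * g y - f y * pd i g y) / g y ^ 2 := by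
  simp only [div_eq_mul_inv]
  rw [pd_mul i hf (hg.fun_inv h0), pd_inv i hg h0]
  field_simp
  ring

theorem pd_pow (m : ℕ) (hf : DifferentiableAt ℝ f y) :
    pd i (fun z => f z ^ m) y = m * f y ^ (m - 1) * pd i f y := by
  have := (hasDerivAt_pow m (f y)).comp_hasFDerivAt y hf.hasFDerivAt
  have h2 : fderiv ℝ (fun z => f z ^ m) y = _ := this.fderiv
  simp [pd, h2]

theorem pd_sqrt (hf : DifferentiableAt ℝ f y) (h0 : f y ≠ 0) :
    pd i (fun z => √(f z)) y = pd i f y / (2 * √(f y)) := by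
  have := (Real.hasDerivAt_sqrt h0).comp_hasFDerivAt y hf.hasFDerivAt
  have h2 : fderiv ℝ (fun z => √(f z)) y = _ := this.fderiv
  simp [pd, h2]; ring

theorem pd_coord : pd i (fun z : Coord n => z j) y = if i = j then 1 else 0 := by
  have h : (fun z : Coord n => z j) = EuclideanSpace.proj (𝕜 := ℝ) j := rfl
  rw [pd, h, ContinuousLinearMap.fderiv]
  simp [eq_comm]

theorem pd_congr (h : f =ᶠ[𝓝 y] g) : pd i f y = pd i g y := by
  simp [pd, h.fderiv_eq]

@[fun_prop]
theorem contDiff_pd (hf : ContDiff ℝ ∞ f) : ContDiff ℝ ∞ (pd i f) := by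
  have : ContDiff ℝ ∞ (fderiv ℝ f) := hf.fderiv_right (by simp)
  exact this.clm_apply contDiff_const

@[fun_prop]
theorem differentiable_pd (hf : ContDiff ℝ ∞ f) : Differentiable ℝ (pd i f) :=
  (contDiff_pd i hf).differentiable (by simp)

theorem pd_comm (hf : ContDiff ℝ ∞ f) : pd i (pd j f) y = pd j (pd i f) y := by
  have h1 : ContDiff ℝ ∞ (fderiv ℝ f) := hf.fderiv_right (by simp)
  have h2 : DifferentiableAt ℝ (fderiv ℝ f) y := h1.differentiable (by simp) y
  have key : ∀ (i j : Fin n), pd i (pd j f) y =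
      fderiv ℝ (fderiv ℝ f) y (EuclideanSpace.single i 1) (EuclideanSpace.single j 1) := by
    intro i j
    unfold pd
    rw [fderiv_clm_apply h2 (differentiableAt_const _)]
    simp
  rw [key, key]
  exact (hf.contDiffAt.isSymmSndFDerivAt (by simpa using ENat.LEInfty.out)).eq _ _

theorem euclidean_eq_sum (x : Coord n) :
    x = ∑ i, x i • EuclideanSpace.single i (1 : ℝ) := by
  ext a
  simp [Pi.single_apply]

theorem fderiv_single_apply {m : ℕ} {w : Coord n → Coord m} {y : Coord n} (i : Fin n)
    (hw : ∀ a, DifferentiableAt ℝ (fun z => w z a) y) (a : Fin m) :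
    fderiv ℝ w y (EuclideanSpace.single i 1) a = pd i (fun z => w z a) y := by
  have hw' : DifferentiableAt ℝ w y := differentiableAt_euclidean.2 hw
  have : HasFDerivAt (fun z => w z a) _ y :=
    ((EuclideanSpace.proj (𝕜 := ℝ) a).hasFDerivAt).comp y hw'.hasFDerivAt
  rw [pd, this.fderiv]
  rfl

/-- The chain rule, for a scalar function composed with a map between coordinate spaces. -/
theorem pd_comp {m : ℕ} {f : Coord m → ℝ} {w : Coord n → Coord m} {y : Coord n} (i : Fin n)
    (hf : DifferentiableAt ℝ f (w y)) (hw : ∀ a, DifferentiableAt ℝ (fun z => w z a) y) :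
    pd i (fun z => f (w z)) y = ∑ a, pd i (fun z => w z a) y * pd a f (w y) := by
  have h1 : fderiv ℝ (fun z => f (w z)) y = _ :=
    fderiv_comp y hf (differentiableAt_euclidean.2 hw)
  rw [pd, h1, ContinuousLinearMap.comp_apply, euclidean_eq_sum (fderiv ℝ w y _)]
  simp [pd, fderiv_single_apply i hw]

end PartialDerivatives

/-! ### Curvature as the curl of a connection form -/

/-- The coefficients of the connection form of the metric `G` on the plane, for the symmetric
orthonormal frame `G^{-1/2}`. The normalization is such that its curl is the scalar curvature
density. -/
def connForm (G : Coord 2 → Matrix (Fin 2) (Fin 2) ℝ) (i : Fin 2) (y : Coord 2) : ℝ :=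
  (pd 1 (fun z => G z 0 i) y - pd 0 (fun z => G z 1 i) y
    - ((G y 0 0 - G y 1 1) * pd i (fun z => G z 0 1) y
        - G y 0 1 * pd i (fun z => G z 0 0 - G z 1 1) y)
      / (G y 0 0 + G y 1 1 + 2 * √(G y 0 0 * G y 1 1 - G y 0 1 ^ 2)))
    / √(G y 0 0 * G y 1 1 - G y 0 1 ^ 2)

/-- The numerator in Brioschi's formula for the scalar curvature of the metric
`a dx² + 2 b dx dy + c dy²`. -/
def brioschi (a b c : Coord 2 → ℝ) (y : Coord 2) : ℝ :=
  2 * ((-pd 1 (pd 1 a) y / 2 + pd 0 (pd 1 b) y - pd 0 (pd 0 c) y / 2) * (a y * c y - b y ^ 2)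
    - pd 0 a y / 2 * ((pd 1 b y - pd 0 c y / 2) * c y - b y * pd 1 c y / 2)
    + (pd 0 b y - pd 1 a y / 2) * ((pd 1 b y - pd 0 c y / 2) * b y - a y * pd 1 c y / 2)
    + pd 1 a y / 2 * (pd 1 a y * c y - b y * pd 0 c y) / 2
    - pd 0 c y / 2 * (pd 1 a y * b y - a y * pd 0 c y) / 2)

section Scalar

variable {a b c : Coord 2 → ℝ}

/-- The Christoffel symbols of the metric `a dx² + 2 b dx dy + c dy²`. -/
theorem christoffel_two (k i j : Fin 2) (h0 : ∀ z, a z * c z - b z ^ 2 ≠ 0) :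
    christoffel (fun z => !![a z, b z; b z, c z]) k i j =
    match k, i, j with
    | 0, 0, 0 => fun z => (c z * pd 0 a z - b z * (2 * pd 0 b z - pd 1 a z)) /
        (2 * (a z * c z - b z ^ 2))
    | 0, 1, 1 => fun z => (c z * (2 * pd 1 b z - pd 0 c z) - b z * pd 1 c z) /
        (2 * (a z * c z - b z ^ 2))
    | 0, _, _ => fun z => (c z * pd 1 a z - b z * pd 0 c z) / (2 * (a z * c z - b z ^ 2))
    | 1, 0, 0 => fun z => (a z * (2 * pd 0 b z - pd 1 a z) - b z * pd 0 a z) /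
        (2 * (a z * c z - b z ^ 2))
    | 1, 1, 1 => fun z => (a z * pd 1 c z - b z * (2 * pd 1 b z - pd 0 c z)) /
        (2 * (a z * c z - b z ^ 2))
    | 1, _, _ => fun z => (a z * pd 0 c z - b z * pd 1 a z) / (2 * (a z * c z - b z ^ 2)) := by
  ext z
  have h := h0 z
  have h' : a z * c z - b z * b z ≠ 0 := by rwa [← sq]
  fin_cases k <;> fin_cases i <;> fin_cases j <;>
    simp [christoffel, Fin.sum_univ_two, Matrix.inv_def, Matrix.det_fin_two,
      Matrix.adjugate_fin_two, Ring.inverse_eq_inv'] <;> field_simp <;> ring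

/-- Brioschi's formula. -/
theorem scalarCurv_two (ha : ContDiff ℝ ∞ a) (hb : ContDiff ℝ ∞ b) (hc : ContDiff ℝ ∞ c)
    (h0 : ∀ z, a z * c z - b z ^ 2 ≠ 0) (y : Coord 2) :
    scalarCurv (fun z => !![a z, b z; b z, c z]) y =
      brioschi a b c y / (a y * c y - b y ^ 2) ^ 2 := by
  have ha' := ha.differentiable (by simp)
  have hb' := hb.differentiable (by simp)
  have hc' := hc.differentiable (by simp)
  have h := h0 y
  have h' : a y * c y - b y * b y ≠ 0 := by rwa [← sq]
  have h2 : 2 * (a y * c y - b y ^ 2) ≠ 0 := mul_ne_zero two_ne_zero h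
  have e0 := pd_comm (y := y) 1 0 ha
  have e1 := pd_comm (y := y) 1 0 hb
  have e2 := pd_comm (y := y) 1 0 hc
  simp only [brioschi, scalarCurv, ricci, Fin.sum_univ_two, christoffel_two _ _ _ h0,
    sub_self, zero_add]
  simp (disch := first | assumption | fun_prop (disch := assumption)) only [pd_div, pd_sub,
    pd_mul, pd_const, pd_pow, e0, e1, e2]
  simp [Matrix.inv_def, Matrix.det_fin_two,
      Matrix.adjugate_fin_two, Ring.inverse_eq_inv']
  generalize pd 1 (pd 1 a) y = a11
  generalize pd 1 (pd 1 b) y = b11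
  generalize pd 1 (pd 1 c) y = c11
  generalize pd 0 (pd 1 a) y = a01
  generalize pd 0 (pd 1 b) y = b01
  generalize pd 0 (pd 1 c) y = c01
  generalize pd 0 (pd 0 a) y = a00
  generalize pd 0 (pd 0 b) y = b00
  generalize pd 0 (pd 0 c) y = c00
  generalize pd 0 a y = a0
  generalize pd 0 b y = b0
  generalize pd 0 c y = c0
  generalize pd 1 a y = a1
  generalize pd 1 b y = b1
  generalize pd 1 c y = c1
  generalize a y = A at *
  generalize b y = B at *
  generalize c y = C at *
  obtain ⟨d, hd⟩ : ∃ d, d = A * C - B ^2 := ⟨_, rfl⟩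
  rw [← sq, ← hd]
  rw [← hd] at h
  field_simp
  rw [hd]
  ring

theorem curl_connForm_two (ha : ContDiff ℝ ∞ a) (hb : ContDiff ℝ ∞ b) (hc : ContDiff ℝ ∞ c)
    (hpos : ∀ z, 0 < a z) (h0 : ∀ z, 0 < a z * c z - b z ^ 2) (y : Coord 2) :
    pd 0 (connForm (fun z => !![a z, b z; b z, c z]) 1) y
      - pd 1 (connForm (fun z => !![a z, b z; b z, c z]) 0) y =
      brioschi a b c y / √(a y * c y - b y ^ 2) ^ 3 := by
  have ha' := ha.differentiable (by simp)
  have hb' := hb.differentiable (by simp)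
  have hc' := hc.differentiable (by simp)
  have hcpos : ∀ z, 0 < c z := fun z => by
    by_contra hcon
    nlinarith [h0 z, hpos z, sq_nonneg (b z), mul_nonneg (hpos z).le (neg_nonneg.2 (not_lt.1 hcon))]
  have hD : ∀ z, 0 < √(a z * c z - b z ^ 2) := fun z => Real.sqrt_pos.2 (h0 z)
  have h1 := (h0 y).ne'
  have h2 := (hD y).ne'
  have h3 : a y + c y + 2 * √(a y * c y - b y ^ 2) ≠ 0 :=
    (add_pos (add_pos (hpos y) (hcpos y)) (mul_pos two_pos (hD y))).ne'
  have e0 := pd_comm (y := y) 1 0 ha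
  have e1 := pd_comm (y := y) 1 0 hb
  have e2 := pd_comm (y := y) 1 0 hc
  have hDd : DifferentiableAt ℝ (fun z => √(a z * c z - b z ^ 2)) y := by
    fun_prop (disch := assumption)
  have hpa : ∀ i z, pd i (fun z => a z - c z) z = pd i a z - pd i c z :=
    fun i z => pd_sub i (ha' z) (hc' z)
  have hform : ∀ i, connForm (fun z => !![a z, b z; b z, c z]) i = fun z =>
    (pd 1 (if i = 0 then a else b) z - pd 0 (if i = 0 then b else c) z
      - ((a z - c z) * pd i b z - b z * (pd i a z - pd i c z))
      / (a z + c z + 2 * √(a z * c z - b z ^ 2))) / √(a z * c z - b z ^ 2) := by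
    intro i
    ext z
    fin_cases i <;> simp [connForm, hpa]
  have hsq : √(a y * c y - b y ^ 2) ^ 2 = a y * c y - b y ^ 2 := Real.sq_sqrt (h0 y).le
  rw [hform, hform, brioschi]
  simp only [if_true, one_ne_zero, if_false]
  simp (disch := first | assumption | fun_prop (disch := assumption)) only [pd_div, pd_sub, pd_mul,
    pd_add, pd_const, pd_pow, e0, e1, e2, pd_sqrt]
  generalize pd 1 (pd 1 a) y = a11
  generalize pd 1 (pd 1 b) y = b11
  generalize pd 1 (pd 1 c) y = c11
  generalize pd 0 (pd 1 a) y = a01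
  generalize pd 0 (pd 1 b) y = b01
  generalize pd 0 (pd 1 c) y = c01
  generalize pd 0 (pd 0 a) y = a00
  generalize pd 0 (pd 0 b) y = b00
  generalize pd 0 (pd 0 c) y = c00
  generalize pd 0 a y = a0
  generalize pd 0 b y = b0
  generalize pd 0 c y = c0
  generalize pd 1 a y = a1
  generalize pd 1 b y = b1
  generalize pd 1 c y = c1
  have hA := (hpos y).ne'
  generalize √(a y * c y - b y ^ 2) = D at *
  generalize a y = A at *
  generalize b y = B at *
  generalize c y = C at *
  -- Solving `D ^ 2 = A * C - B ^ 2` for `C` leaves free variables, related by no equation.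
  obtain rfl : C = (D ^ 2 + B ^ 2) / A := by field_simp; linarith
  obtain ⟨w, hw⟩ : ∃ w, w = A * (A + 2 * D) + (D ^ 2 + B ^ 2) := ⟨_, rfl⟩
  have e4 : A * ((D ^ 2 + B ^ 2) / A) - B ^ 2 = D ^ 2 := by field_simp; ring
  have e5 : A + (D ^ 2 + B ^ 2) / A + 2 * D = w / A := by
    rw [hw]; field_simp; ring
  have h4 : w ≠ 0 := by
    rintro rfl
    exact h3 (by rw [e5, zero_div])
  simp only [e4, e5]
  field_simp
  rw [hw]
  ring

end Scalar

/-- Smooth Riemannian metrics on the plane, in terms of their coefficients. -/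
structure IsPlaneMetric (G : Coord 2 → Matrix (Fin 2) (Fin 2) ℝ) : Prop where
  smooth : ∀ i j, ContDiff ℝ ∞ (fun z => G z i j)
  posDef : ∀ z, (G z).PosDef

namespace IsPlaneMetric

variable {G : Coord 2 → Matrix (Fin 2) (Fin 2) ℝ} (hG : IsPlaneMetric G)

include hG

theorem symm (z : Coord 2) : G z 1 0 = G z 0 1 := by
  simpa using (hG.posDef z).isHermitian.apply 0 1

theorem eq_of : G = fun z => !![G z 0 0, G z 0 1; G z 0 1, G z 1 1] := by
  ext z i j
  fin_cases i <;> fin_cases j <;> simp [hG.symm]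

theorem pos (z : Coord 2) : 0 < G z 0 0 := (hG.posDef z).diag_pos

theorem det_eq (z : Coord 2) : (G z).det = G z 0 0 * G z 1 1 - G z 0 1 ^ 2 := by
  rw [Matrix.det_fin_two, hG.symm, sq]

theorem det_pos (z : Coord 2) : 0 < G z 0 0 * G z 1 1 - G z 0 1 ^ 2 := by
  rw [← hG.det_eq]
  exact (hG.posDef z).det_pos

/-- The scalar curvature density of a metric on the plane is the curl of its connection form. -/
theorem scalarCurv_mul_sqrt_det (y : Coord 2) :
    scalarCurv G y * √(G y).det = pd 0 (connForm G 1) y - pd 1 (connForm G 0) y := by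
  rw [hG.det_eq]
  have hpos := hG.det_pos
  have hR := scalarCurv_two (hG.smooth 0 0) (hG.smooth 0 1) (hG.smooth 1 1)
    (fun z => (hpos z).ne') y
  have hC := curl_connForm_two (hG.smooth 0 0) (hG.smooth 0 1) (hG.smooth 1 1) hG.pos hpos y
  rw [← hG.eq_of] at hR hC
  rw [hR, hC]
  have h1 := Real.sqrt_pos.2 (hpos y)
  have h2 := Real.sq_sqrt (hpos y).le
  generalize √(G y 0 0 * G y 1 1 - G y 0 1 ^ 2) = D at *
  rw [← h2]
  field_simp

theorem contDiff_connForm (i : Fin 2) : ContDiff ℝ ∞ (connForm G i) := by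
  have h00 := hG.smooth 0 0
  have h01 := hG.smooth 0 1
  have h10 := hG.smooth 1 0
  have h11 := hG.smooth 1 1
  have hpos := fun z => (hG.det_pos z).ne'
  have hD : ContDiff ℝ ∞ (fun z => √(G z 0 0 * G z 1 1 - G z 0 1 ^ 2)) :=
    ContDiff.sqrt (by fun_prop) hpos
  have hD0 := fun z => (Real.sqrt_pos.2 (hG.det_pos z))
  have hc : ∀ z, 0 < G z 1 1 := fun z => (hG.posDef z).diag_pos
  have hS : ∀ z, G z 0 0 + G z 1 1 + 2 * √(G z 0 0 * G z 1 1 - G z 0 1 ^ 2) ≠ 0 := fun z =>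
    (add_pos (add_pos (hG.pos z) (hc z)) (mul_pos two_pos (hD0 z))).ne'
  have h0i := hG.smooth 0 i
  have h1i := hG.smooth 1 i
  unfold connForm
  refine ContDiff.div (((contDiff_pd _ h0i).sub (contDiff_pd _ h1i)).sub
    (ContDiff.div
      (((h00.sub h11).mul (contDiff_pd _ h01)).sub (h01.mul (contDiff_pd _ (h00.sub h11))))
      ((h00.add h11).add (contDiff_const.mul hD)) hS)) hD fun z => (hD0 z).ne'

theorem continuous_sqrt_det : Continuous fun z => √(G z).det := by
  have h00 := (hG.smooth 0 0).continuous
  have h01 := (hG.smooth 0 1).continuous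
  have h11 := (hG.smooth 1 1).continuous
  simp only [hG.det_eq]
  fun_prop

end IsPlaneMetric

/-! ### The inversion of the plane -/

/-- The inversion `z ↦ z / |z|²` of the plane, with value `0` at the origin. -/
def inversion (z : Coord 2) : Coord 2 := (z 0 ^ 2 + z 1 ^ 2)⁻¹ • z

theorem inversion_apply (z : Coord 2) (a : Fin 2) :
    inversion z a = z a / (z 0 ^ 2 + z 1 ^ 2) := by
  simp [inversion]; ring

theorem sq_add_sq_pos {z : Coord 2} (hz : z ≠ 0) : 0 < z 0 ^ 2 + z 1 ^ 2 := by
  have : ‖z‖ ^ 2 = z 0 ^ 2 + z 1 ^ 2 := by simp [EuclideanSpace.norm_sq_eq]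
  rw [← this]
  positivity

theorem differentiableAt_inversion {z : Coord 2} (hz : z ≠ 0) (a : Fin 2) :
    DifferentiableAt ℝ (fun z => inversion z a) z := by
  have := (sq_add_sq_pos hz).ne'
  simp only [inversion_apply]
  fun_prop (disch := assumption)

theorem pd_inversion {z : Coord 2} (hz : z ≠ 0) (i a : Fin 2) :
    pd i (fun z => inversion z a) z =
      ((if i = a then 1 else 0) * (z 0 ^ 2 + z 1 ^ 2) - 2 * z i * z a) /
        (z 0 ^ 2 + z 1 ^ 2) ^ 2 := by
  have := (sq_add_sq_pos hz).ne'
  simp only [inversion_apply]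
  simp (disch := first | assumption | fun_prop) only [pd_div, pd_add, pd_pow, pd_coord]
  fin_cases i <;> fin_cases a <;> simp <;> ring

/-- `G` is the pullback of the metric `H` under the inversion of the punctured plane. -/
def IsInversionPullback (G H : Coord 2 → Matrix (Fin 2) (Fin 2) ℝ) : Prop :=
  ∀ z ≠ 0, ∀ i j, G z i j = ∑ a, ∑ b, pd i (fun z => inversion z a) z *
    pd j (fun z => inversion z b) z * H (inversion z) a b

section Inversion

variable {G H : Coord 2 → Matrix (Fin 2) (Fin 2) ℝ}

/-- The area density is multiplied by the Jacobian `|z|⁻⁴` of the inversion. -/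
theorem IsInversionPullback.sqrt_det (hG : IsPlaneMetric G) (hH : IsPlaneMetric H)
    (h : IsInversionPullback G H) {z : Coord 2} (hz : z ≠ 0) :
    √(G z 0 0 * G z 1 1 - G z 0 1 ^ 2) =
      √(H (inversion z) 0 0 * H (inversion z) 1 1 - H (inversion z) 0 1 ^ 2) /
        (z 0 ^ 2 + z 1 ^ 2) ^ 2 := by
  have h0 := sq_add_sq_pos hz
  rw [Real.sqrt_eq_iff_mul_self_eq (hG.det_pos z).le (by positivity), div_mul_div_comm,
    Real.mul_self_sqrt (hH.det_pos _).le]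
  simp only [h z hz, Fin.sum_univ_two, pd_inversion hz, hH.symm]
  simp
  field_simp
  ring

/-- The transformation law of the connection form under the inversion. The form `4 dθ` accounts for
the rotation of the frame, and the sign of the second term for the reversal of orientation. -/
theorem IsInversionPullback.connForm_eq (hG : IsPlaneMetric G) (hH : IsPlaneMetric H)
    (h : IsInversionPullback G H) {z : Coord 2} (hz : z ≠ 0) (i : Fin 2) :
    connForm G i z = 4 * (if i = 0 then -z 1 else z 0) / (z 0 ^ 2 + z 1 ^ 2)
      - ∑ a, pd i (fun z => inversion z a) z * connForm H a (inversion z) := by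
  have h0 := (sq_add_sq_pos hz).ne'
  have hs := h.sqrt_det hG hH hz
  have hH00 := (hH.smooth 0 0).differentiable (by simp) (inversion z)
  have hH01 := (hH.smooth 0 1).differentiable (by simp) (inversion z)
  have hH11 := (hH.smooth 1 1).differentiable (by simp) (inversion z)
  have c00 := fun k => pd_comp k hH00 (differentiableAt_inversion hz)
  have c01 := fun k => pd_comp k hH01 (differentiableAt_inversion hz)
  have c11 := fun k => pd_comp k hH11 (differentiableAt_inversion hz)
  have hinv : DifferentiableAt ℝ inversion z :=
    differentiableAt_euclidean.2 (differentiableAt_inversion hz)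
  have d00 : DifferentiableAt ℝ (fun y => H (inversion y) 0 0) z := hH00.comp z hinv
  have d01 : DifferentiableAt ℝ (fun y => H (inversion y) 0 1) z := hH01.comp z hinv
  have d11 : DifferentiableAt ℝ (fun y => H (inversion y) 1 1) z := hH11.comp z hinv
  have hne : ∀ᶠ y in 𝓝 z, y ≠ 0 := isOpen_ne.mem_nhds hz
  have x00 : ∀ y, y ≠ 0 → G y 0 0 = ((y 0 ^ 2 - y 1 ^ 2) ^ 2 * H (inversion y) 0 0 +
      4 * (y 0 ^ 2 - y 1 ^ 2) * (y 0 * y 1) * H (inversion y) 0 1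
      + 4 * (y 0 * y 1) ^ 2 * H (inversion y) 1 1) / (y 0 ^ 2 + y 1 ^ 2) ^ 4 := by
    intro y hy
    have := (sq_add_sq_pos hy).ne'
    simp only [h y hy, Fin.sum_univ_two, pd_inversion hy, hH.symm]
    simp
    field_simp
    ring
  have x01 : ∀ y, y ≠ 0 → G y 0 1 = (2 * (y 0 ^ 2 - y 1 ^ 2) * (y 0 * y 1) *
      (H (inversion y) 0 0 - H (inversion y) 1 1) +
      (4 * (y 0 * y 1) ^ 2 - (y 0 ^ 2 - y 1 ^ 2) ^ 2) * H (inversion y) 0 1)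
      / (y 0 ^ 2 + y 1 ^ 2) ^ 4 := by
    intro y hy
    have := (sq_add_sq_pos hy).ne'
    simp only [h y hy, Fin.sum_univ_two, pd_inversion hy, hH.symm]
    simp
    field_simp
    ring
  have x11 : ∀ y, y ≠ 0 → G y 1 1 = ((y 0 ^ 2 - y 1 ^ 2) ^ 2 * H (inversion y) 1 1 -
      4 * (y 0 ^ 2 - y 1 ^ 2) * (y 0 * y 1) * H (inversion y) 0 1
      + 4 * (y 0 * y 1) ^ 2 * H (inversion y) 0 0) / (y 0 ^ 2 + y 1 ^ 2) ^ 4 := by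
    intro y hy
    have := (sq_add_sq_pos hy).ne'
    simp only [h y hy, Fin.sum_univ_two, pd_inversion hy, hH.symm]
    simp
    field_simp
    ring
  have p00 : ∀ k, pd k (fun y => G y 0 0) z = _ := fun k =>
    pd_congr k (hne.mono x00)
  have p01 : ∀ k, pd k (fun y => G y 0 1) z = _ := fun k =>
    pd_congr k (hne.mono x01)
  have p11 : ∀ k, pd k (fun y => G y 1 1) z = _ := fun k =>
    pd_congr k (hne.mono x11)
  have e4 : (z 0 ^ 2 + z 1 ^ 2) ^ 4 ≠ 0 := pow_ne_zero _ h0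
  simp (disch := first | assumption | fun_prop (disch := assumption)) only [pd_div, pd_add,
    pd_sub, pd_mul, pd_const, pd_pow, pd_coord, c00, c01, c11, Fin.sum_univ_two] at p00 p01 p11
  have hG00 := (hG.smooth 0 0).differentiable (by simp) z
  have hG11 := (hG.smooth 1 1).differentiable (by simp) z
  have hD := (Real.sqrt_pos.2 (hH.det_pos (inversion z))).ne'
  have hsq := Real.sq_sqrt (hH.det_pos (inversion z)).le
  have hS : H (inversion z) 0 0 + H (inversion z) 1 1 +
      2 * √(H (inversion z) 0 0 * H (inversion z) 1 1 - H (inversion z) 0 1 ^ 2) ≠ 0 :=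
    (add_pos (add_pos (hH.pos _) (hH.posDef _).diag_pos)
      (mul_pos two_pos (Real.sqrt_pos.2 (hH.det_pos (inversion z))))).ne'
  have hA := (hH.pos (inversion z)).ne'
  have q := fun i => pd_sub i hG00 hG11
  have qH := fun i => pd_sub i hH00 hH11
  simp only [connForm, Fin.sum_univ_two, q, qH, hs, pd_inversion hz, hH.symm]
  have ht := x00 z hz
  have ht1 := x11 z hz
  have htr : G z 0 0 + G z 1 1 =
      (H (inversion z) 0 0 + H (inversion z) 1 1) / (z 0 ^ 2 + z 1 ^ 2) ^ 2 := by
    rw [ht, ht1]; field_simp; ring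
  rw [htr, x00 z hz, x01 z hz, x11 z hz]
  clear ht ht1 htr x00 x01 x11 d00 d01 d11 c00 c01 c11 hs
  fin_cases i
  all_goals
    simp only [Fin.zero_eta, Fin.mk_one, p00, p01, p11, pd_inversion hz, hG.symm]
    simp only [Fin.isValue, if_true, one_ne_zero, zero_ne_one, if_false]
    clear p00 p01 p11 q qH
    generalize pd 0 (fun y => H y 0 0) (inversion z) = a0
    generalize pd 0 (fun y => H y 0 1) (inversion z) = b0
    generalize pd 0 (fun y => H y 1 1) (inversion z) = c0
    generalize pd 1 (fun y => H y 0 0) (inversion z) = a1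
    generalize pd 1 (fun y => H y 0 1) (inversion z) = b1
    generalize pd 1 (fun y => H y 1 1) (inversion z) = c1
    generalize √(H (inversion z) 0 0 * H (inversion z) 1 1 - H (inversion z) 0 1 ^ 2) = D at *
    generalize H (inversion z) 0 0 = A at *
    generalize H (inversion z) 0 1 = B at *
    generalize H (inversion z) 1 1 = C at *
    generalize z 0 = x at *
    generalize z 1 = y at *
    -- As `D ^ 2 = A * C - B ^ 2`, the remaining variables are free once `C` is eliminated.
    obtain rfl : C = (D ^ 2 + B ^ 2) / A := by field_simp; linarith
    obtain ⟨w, hw⟩ : ∃ w, w = A * (A + 2 * D) + (D ^ 2 + B ^ 2) := ⟨_, rfl⟩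
    have e5 : A + (D ^ 2 + B ^ 2) / A + 2 * D = w / A := by
      rw [hw]; field_simp; ring
    have h4 : w ≠ 0 := by
      rintro rfl
      exact hS (by rw [e5, zero_div])
    have e6 : (A + (D ^ 2 + B ^ 2) / A) / (x ^ 2 + y ^ 2) ^ 2 + 2 * (D / (x ^ 2 + y ^ 2) ^ 2) =
      w / A / (x ^ 2 + y ^ 2) ^ 2 := by rw [← e5]; ring
    rw [e5, e6]
    obtain ⟨N, hN⟩ : ∃ N, N = x ^ 2 + y ^ 2 := ⟨_, rfl⟩
    rw [← hN] at h0 e4 ⊢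
    field_simp
    rw [hw, hN]
    push_cast
    ring

/-- The scalar curvature density transforms as a density, as `dθ` is closed. -/
theorem IsInversionPullback.curl_connForm_eq (hG : IsPlaneMetric G) (hH : IsPlaneMetric H)
    (h : IsInversionPullback G H) {z : Coord 2} (hz : z ≠ 0) :
    pd 0 (connForm G 1) z - pd 1 (connForm G 0) z =
      (pd 0 (connForm H 1) (inversion z) - pd 1 (connForm H 0) (inversion z))
        / (z 0 ^ 2 + z 1 ^ 2) ^ 2 := by
  have h0 := (sq_add_sq_pos hz).ne'
  have h0' := pow_ne_zero 2 h0
  have hne : ∀ᶠ y in 𝓝 z, y ≠ 0 := isOpen_ne.mem_nhds hz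
  have hinv : DifferentiableAt ℝ inversion z :=
    differentiableAt_euclidean.2 (differentiableAt_inversion hz)
  have hH' := fun i => (hH.contDiff_connForm i).differentiable (by simp) (inversion z)
  have hc := fun k a => pd_comp k (hH' a) (differentiableAt_inversion hz)
  have d := fun a => DifferentiableAt.comp z (hH' a) hinv
  simp only [Function.comp_def] at d
  have key : ∀ k i, pd k (connForm G i) z = _ := fun k i =>
    pd_congr (g := fun y =>
      4 * (if i = 0 then -y 1 else y 0) / (y 0 ^ 2 + y 1 ^ 2)
      - ∑ a, ((if i = a then 1 else 0) * (y 0 ^ 2 + y 1 ^ 2) - 2 * y i * y a)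
        / (y 0 ^ 2 + y 1 ^ 2) ^ 2 * connForm H a (inversion y)) k
      (hne.mono fun y hy => by rw [h.connForm_eq hG hH hy]; simp only [pd_inversion hy])
  rw [key, key]
  have d0 := d 0
  have d1 := d 1
  simp only [Fin.sum_univ_two, if_true, one_ne_zero, zero_ne_one, if_false]
  simp (disch := first | assumption | fun_prop (disch := assumption)) only [pd_div, pd_add, pd_sub,
    pd_mul, pd_const, pd_neg, pd_pow, pd_coord, hc, Fin.sum_univ_two, pd_inversion hz]
  simp only [if_true, one_ne_zero, zero_ne_one, if_false]
  push_cast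
  field_simp
  ring

end Inversion

/-! ### Decay at infinity -/

theorem norm_sq_coord (z : Coord 2) : ‖z‖ ^ 2 = z 0 ^ 2 + z 1 ^ 2 := by
  simp [EuclideanSpace.norm_sq_eq]

theorem norm_inversion_le {z : Coord 2} (hz : 1 ≤ ‖z‖) : ‖inversion z‖ ≤ 1 := by
  rw [inversion, ← norm_sq_coord, norm_smul, norm_inv, norm_pow, norm_norm]
  rw [sq, mul_inv, mul_assoc, inv_mul_cancel₀ (by positivity), mul_one]
  exact inv_le_one_of_one_le₀ hz

theorem abs_coord_le (z : Coord 2) (i : Fin 2) : |z i| ≤ ‖z‖ := by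
  simpa using PiLp.norm_apply_le z i

theorem exists_bound_comp_inversion {f : Coord 2 → ℝ} (hf : Continuous f) :
    ∃ C, 0 ≤ C ∧ ∀ z : Coord 2, 1 ≤ ‖z‖ → |f (inversion z)| ≤ C := by
  obtain ⟨C, hC⟩ := (isCompact_closedBall (0 : Coord 2) 1).exists_bound_of_continuousOn
    hf.continuousOn
  refine ⟨max C 0, le_max_right _ _, fun z hz => (hC _ ?_).trans (le_max_left _ _)⟩
  simpa using norm_inversion_le hz

/-- A continuous function on the plane that is `O(|z|⁻⁴)` is integrable. -/
theorem integrable_of_decay {f : Coord 2 → ℝ} (hf : Continuous f) {C : ℝ}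
    (h : ∀ z : Coord 2, 1 ≤ ‖z‖ → |f z| ≤ C / ‖z‖ ^ 4) : Integrable f := by
  have hint : Integrable (fun z : Coord 2 => (1 + ‖z‖ ^ 2) ^ (-(4 : ℝ) / 2)) :=
    integrable_rpow_neg_one_add_norm_sq (by simp; norm_num)
  obtain ⟨K, hK⟩ := (isCompact_closedBall (0 : Coord 2) 1).exists_bound_of_continuousOn
    hf.continuousOn
  refine (hint.const_mul (4 * max C K)).mono' hf.aestronglyMeasurable
    (Filter.Eventually.of_forall fun z => ?_)
  have e : (1 + ‖z‖ ^ 2) ^ (-(4 : ℝ) / 2) = 1 / (1 + ‖z‖ ^ 2) ^ 2 := by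
    rw [show -(4 : ℝ) / 2 = -(2 : ℕ) by norm_num, Real.rpow_neg (by positivity),
      Real.rpow_natCast, one_div]
  rw [e, mul_one_div, Real.norm_eq_abs]
  have hp : 0 < (1 + ‖z‖ ^ 2) ^ 2 := by positivity
  rcases le_total 1 ‖z‖ with hz | hz
  · refine (h z hz).trans ?_
    have hC : 0 ≤ C := by
      have h4 := (abs_nonneg _).trans (h z hz)
      by_contra hcon
      exact absurd h4 (not_le.2 (div_neg_of_neg_of_pos (not_le.1 hcon) (by positivity)))
    rw [div_le_div_iff₀ (by positivity) hp]
    have h5 : (1 + ‖z‖ ^ 2) ^ 2 ≤ 4 * ‖z‖ ^ 4 := by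
      nlinarith [sq_nonneg (‖z‖ ^ 2), one_le_pow₀ hz (n := 2)]
    calc C * (1 + ‖z‖ ^ 2) ^ 2 ≤ C * (4 * ‖z‖ ^ 4) := by gcongr
      _ ≤ max C K * (4 * ‖z‖ ^ 4) := by gcongr; exact le_max_left _ _
      _ = _ := by ring
  · have h1 := hK z (by simpa using hz)
    have hK0 : 0 ≤ K := (norm_nonneg _).trans h1
    refine h1.trans ?_
    rw [le_div_iff₀ hp]
    have h5 : (1 + ‖z‖ ^ 2) ^ 2 ≤ 4 := by
      have : ‖z‖ ^ 2 ≤ 1 := pow_le_one₀ (norm_nonneg _) hz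
      nlinarith [sq_nonneg ‖z‖]
    calc K * (1 + ‖z‖ ^ 2) ^ 2 ≤ K * 4 := by gcongr
      _ ≤ max C K * 4 := by gcongr; exact le_max_right _ _
      _ = _ := by ring

/-! ### Integrals of curls over the plane -/

theorem integral_bump_mul_pd {χ p : Coord 2 → ℝ} (hχ : ContDiff ℝ ∞ χ) (hc : HasCompactSupport χ)
    (hp : ContDiff ℝ ∞ p) (i : Fin 2) :
    ∫ z, χ z * pd i p z = -∫ z, pd i χ z * p z := by
  have hc' : HasCompactSupport (pd i χ) := by
    refine hc.mono' ?_
    intro z hz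
    by_contra hcon
    apply hz
    have : χ =ᶠ[𝓝 z] 0 := notMem_tsupport_iff_eventuallyEq.1 hcon
    rw [pd_congr i this]
    exact pd_const i 0
  refine integral_mul_fderiv_eq_neg_fderiv_mul_of_integrable ?_ ?_ ?_ ?_ ?_
  · exact ((contDiff_pd i hχ).continuous.mul hp.continuous).integrable_of_hasCompactSupport
      hc'.mul_right
  · exact (hχ.continuous.mul (contDiff_pd i hp).continuous).integrable_of_hasCompactSupport
      hc.mul_right
  · exact (hχ.continuous.mul hp.continuous).integrable_of_hasCompactSupport hc.mul_right
  · exact fun z _ => hχ.differentiable (by simp) z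
  · exact fun z _ => hp.differentiable (by simp) z

/-- The bump function equal to `1` on the unit disc and supported in the disc of radius `2`. -/
def unitBump : ContDiffBump (0 : Coord 2) := ⟨1, 2, one_pos, one_lt_two⟩

/-- The cutoff function that is `1` on the disc of radius `n` and `0` outside that of radius `2n`.
The value at `n = 0` is irrelevant. -/
def cutoff (n : ℕ) (z : Coord 2) : ℝ := unitBump ((n : ℝ)⁻¹ • z)

theorem contDiff_cutoff (n : ℕ) : ContDiff ℝ ∞ (cutoff n) :=
  unitBump.contDiff.comp (contDiff_const_smul _)

theorem cutoff_eq_zero {n : ℕ} (hn : 0 < n) {z : Coord 2} (hz : 2 * n ≤ ‖z‖) : cutoff n z = 0 := by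
  apply unitBump.zero_of_le_dist
  have : (0 : ℝ) < n := by exact_mod_cast hn
  rw [dist_zero_right, norm_smul, norm_inv, Real.norm_natCast, inv_mul_eq_div,
    le_div_iff₀ this]
  exact hz

theorem cutoff_eq_one {n : ℕ} (hn : 0 < n) {z : Coord 2} (hz : ‖z‖ ≤ n) : cutoff n z = 1 := by
  apply unitBump.one_of_mem_closedBall
  have : (0 : ℝ) < n := by exact_mod_cast hn
  rw [mem_closedBall_zero_iff, norm_smul, norm_inv, Real.norm_natCast, inv_mul_eq_div,
    div_le_iff₀ this]
  simpa [unitBump] using hz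

theorem hasCompactSupport_cutoff {n : ℕ} (hn : 0 < n) : HasCompactSupport (cutoff n) := by
  refine HasCompactSupport.intro (isCompact_closedBall (0 : Coord 2) (2 * n)) fun z hz => ?_
  apply cutoff_eq_zero hn
  simp at hz
  exact hz.le

theorem pd_cutoff (n : ℕ) (i : Fin 2) (z : Coord 2) :
    pd i (cutoff n) z = (n : ℝ)⁻¹ * pd i unitBump ((n : ℝ)⁻¹ • z) := by
  have h : (fun z => cutoff n z) = fun z => unitBump ((n : ℝ)⁻¹ • z) := rfl
  have hb : ContDiff ℝ ∞ unitBump := unitBump.contDiff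
  change pd i (fun z => unitBump ((fun z => (n : ℝ)⁻¹ • z) z)) z = _
  rw [pd_comp i (hb.differentiable (by simp) _)]
  · simp only [PiLp.smul_apply, smul_eq_mul]
    have : ∀ a, pd i (fun z : Coord 2 => (n : ℝ)⁻¹ * z a) z =
      (n : ℝ)⁻¹ * if i = a then 1 else 0 := by
      intro a
      rw [pd_const_mul, pd_coord]
      fun_prop
    simp [this]
  · intro a
    simp only [PiLp.smul_apply]
    fun_prop

theorem tendsto_integral_cutoff_mul {f : Coord 2 → ℝ} (hf : Integrable f) :
    Tendsto (fun n : ℕ => ∫ z, cutoff n z * f z) atTop (𝓝 (∫ z, f z)) := by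
  refine tendsto_integral_of_dominated_convergence (fun z => ‖f z‖)
    (fun n => (contDiff_cutoff n).continuous.aestronglyMeasurable.mul hf.aestronglyMeasurable)
    hf.norm (fun n => Eventually.of_forall fun z => ?_) (Eventually.of_forall fun z => ?_)
  · rw [norm_mul, Real.norm_eq_abs, cutoff, abs_of_nonneg unitBump.nonneg]
    exact mul_le_of_le_one_left (norm_nonneg _) unitBump.le_one
  · refine tendsto_const_nhds.congr' ?_
    filter_upwards [eventually_ge_atTop (⌈‖z‖⌉₊), eventually_gt_atTop 0] with n hn hn0
    rw [cutoff_eq_one hn0 ((Nat.le_ceil _).trans (by exact_mod_cast hn)), one_mul]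

/-- The derivative of the cutoff function is `O(n⁻¹)` and supported in an annulus of radii `n` and
`2n`, whose area is `O(n²)`, while `p` is `O(n⁻²)` there; the integral is `O(n⁻¹)`. -/
theorem tendsto_integral_pd_cutoff_mul {p : Coord 2 → ℝ} {C : ℝ}
    (hp : ∀ z : Coord 2, 1 ≤ ‖z‖ → |p z| ≤ C / ‖z‖ ^ 2) (i : Fin 2) :
    Tendsto (fun n : ℕ => ∫ z, pd i (cutoff n) z * p z) atTop (𝓝 0) := by
  have hb : ContDiff ℝ ∞ unitBump := unitBump.contDiff
  obtain ⟨M, hM⟩ := (isCompact_closedBall (0 : Coord 2) 2).exists_bound_of_continuousOn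
    (contDiff_pd i hb).continuous.continuousOn
  have hM0 : 0 ≤ M := (norm_nonneg _).trans (hM 0 (by simp))
  set V := (volume : Measure (Coord 2)).real (Metric.ball 0 1) with hV
  rw [tendsto_zero_iff_norm_tendsto_zero]
  have hlim : Tendsto (fun n : ℕ => 4 * M * C * V * (n : ℝ)⁻¹) atTop (𝓝 0) := by
    simpa using (tendsto_inv_atTop_nhds_zero_nat (𝕜 := ℝ)).const_mul (4 * M * C * V)
  refine squeeze_zero' (Eventually.of_forall fun _ => norm_nonneg _) ?_ hlim
  filter_upwards [eventually_gt_atTop 0] with n hn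
  have hn1 : (1 : ℝ) ≤ n := by exact_mod_cast hn
  have hn0 : (0 : ℝ) < n := by linarith
  have hC : 0 ≤ C := by
    have h1 : ‖(EuclideanSpace.single 0 1 : Coord 2)‖ = 1 := by simp
    have := (abs_nonneg _).trans (hp (EuclideanSpace.single 0 1) h1.ge)
    simpa [h1] using this
  have hz0 : ∀ z ∉ Metric.closedBall (0 : Coord 2) (2 * n), pd i (cutoff n) z * p z = 0 := by
    intro z hz
    have : cutoff n =ᶠ[𝓝 z] fun _ => 0 := by
      filter_upwards [Metric.isClosed_closedBall.isOpen_compl.mem_nhds hz] with y hy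
      apply cutoff_eq_zero hn
      simp at hy
      exact hy.le
    rw [pd_congr i this, pd_const, zero_mul]
  have hbound : ∀ z ∈ Metric.closedBall (0 : Coord 2) (2 * n),
      ‖pd i (cutoff n) z * p z‖ ≤ M * C * ((n : ℝ)⁻¹) ^ 3 := by
    intro z hz
    rcases lt_or_ge ‖z‖ n with h | h
    · have : cutoff n =ᶠ[𝓝 z] fun _ => 1 := by
        filter_upwards [Metric.isOpen_ball.mem_nhds (mem_ball_zero_iff.2 h)] with y hy
        exact cutoff_eq_one hn (mem_ball_zero_iff.1 hy).le
      rw [pd_congr i this, pd_const, zero_mul, norm_zero]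
      positivity
    · have h1 : ‖pd i unitBump ((n : ℝ)⁻¹ • z)‖ ≤ M := by
        apply hM
        rw [mem_closedBall_zero_iff] at hz ⊢
        rw [norm_smul, norm_inv, Real.norm_natCast, inv_mul_eq_div, div_le_iff₀ hn0]
        exact hz
      have h2 : ‖p z‖ ≤ C * ((n : ℝ)⁻¹) ^ 2 := by
        refine (hp z (hn1.trans h)).trans ?_
        rw [inv_pow, ← div_eq_mul_inv]
        gcongr
      rw [norm_mul, pd_cutoff, norm_mul, norm_inv, Real.norm_natCast]
      calc (n : ℝ)⁻¹ * ‖pd i unitBump ((n : ℝ)⁻¹ • z)‖ * ‖p z‖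
          ≤ (n : ℝ)⁻¹ * M * (C * ((n : ℝ)⁻¹) ^ 2) := by gcongr
        _ = _ := by ring
  rw [← setIntegral_eq_integral_of_forall_compl_eq_zero hz0]
  refine (norm_setIntegral_le_of_norm_le_const measure_closedBall_lt_top hbound).trans ?_
  rw [Measure.addHaar_real_closedBall _ _ (by positivity)]
  simp only [finrank_euclideanSpace, Fintype.card_fin, ← hV]
  apply le_of_eq
  field_simp
  ring

/-- The integral over the plane of the curl of a form that is `O(|z|⁻²)` vanishes. -/
theorem integral_curl_eq_zero {p : Fin 2 → Coord 2 → ℝ} (hp : ∀ i, ContDiff ℝ ∞ (p i)) {C : ℝ}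
    (hdecay : ∀ i, ∀ z : Coord 2, 1 ≤ ‖z‖ → |p i z| ≤ C / ‖z‖ ^ 2)
    (hint : Integrable fun z => pd 0 (p 1) z - pd 1 (p 0) z) :
    ∫ z, (pd 0 (p 1) z - pd 1 (p 0) z) = 0 := by
  refine tendsto_nhds_unique (tendsto_integral_cutoff_mul hint) ?_
  have h := (tendsto_integral_pd_cutoff_mul (hdecay 0) 1).sub
    (tendsto_integral_pd_cutoff_mul (hdecay 1) 0)
  rw [sub_zero] at h
  refine h.congr' ?_
  filter_upwards [eventually_gt_atTop 0] with n hn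
  have hc := hasCompactSupport_cutoff hn
  have hi : ∀ k i, Integrable fun z => cutoff n z * pd k (p i) z := fun k i =>
    ((contDiff_cutoff n).continuous.mul (contDiff_pd k (hp i)).continuous
      ).integrable_of_hasCompactSupport hc.mul_right
  simp only [mul_sub]
  rw [integral_sub (hi 0 1) (hi 1 0), integral_bump_mul_pd (contDiff_cutoff n) hc (hp 1),
    integral_bump_mul_pd (contDiff_cutoff n) hc (hp 0)]
  ring

theorem integral_round_curvature : ∫ z : Coord 2, 8 / (1 + ‖z‖ ^ 2) ^ 2 = 8 * Real.pi := by
  rw [integral_fun_norm_addHaar volume (fun t : ℝ => 8 / (1 + t ^ 2) ^ 2)]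
  have hd : ∀ t ∈ Set.Ici (0 : ℝ), HasDerivAt (fun t : ℝ => -4 / (1 + t ^ 2))
      (t ^ (Module.finrank ℝ (Coord 2) - 1) • (8 / (1 + t ^ 2) ^ 2)) t := by
    intro t _
    have h1 : HasDerivAt (fun t : ℝ => 1 + t ^ 2) (2 * t) t := by
      simpa using (hasDerivAt_pow 2 t).const_add 1
    have := (hasDerivAt_const t (-4 : ℝ)).div h1 (by positivity)
    convert! this using 1
    simp
    ring
  have hlim : Tendsto (fun t : ℝ => -4 / (1 + t ^ 2)) atTop (𝓝 0) := by
    refine Tendsto.div_atTop tendsto_const_nhds ?_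
    exact tendsto_atTop_add_const_left _ _ (tendsto_pow_atTop two_ne_zero)
  rw [integral_Ioi_of_hasDerivAt_of_nonneg' hd (fun t ht => ?_) hlim]
  · simp [measureReal_def, ENNReal.toReal_ofReal Real.pi_pos.le]
    ring
  · have : (0 : ℝ) < t := ht
    rw [smul_eq_mul]
    positivity

/-! ### The Gauss–Bonnet theorem in stereographic coordinates -/

/-- The coefficients of the form `4 (x dy - y dx) / (1 + |z|²)`, which is smooth on the plane and
whose curl is the scalar curvature density of a round sphere. -/
def roundForm (i : Fin 2) (z : Coord 2) : ℝ :=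
  4 * (if i = 0 then -z 1 else z 0) / (1 + (z 0 ^ 2 + z 1 ^ 2))

theorem contDiff_roundForm (i : Fin 2) : ContDiff ℝ ∞ (roundForm i) := by
  have h : ∀ z : Coord 2, 1 + (z 0 ^ 2 + z 1 ^ 2) ≠ 0 := fun z => by positivity
  have hc : ∀ j, ContDiff ℝ ∞ fun z : Coord 2 => z j := fun j => by fun_prop
  unfold roundForm
  refine ContDiff.div ?_ (by fun_prop) h
  split_ifs <;> fun_prop

theorem curl_roundForm (z : Coord 2) :
    pd 0 (roundForm 1) z - pd 1 (roundForm 0) z = 8 / (1 + ‖z‖ ^ 2) ^ 2 := by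
  have h : 1 + (z 0 ^ 2 + z 1 ^ 2) ≠ 0 := by positivity
  rw [norm_sq_coord]
  unfold roundForm
  simp only [if_true, one_ne_zero, if_false]
  simp (disch := first | assumption | fun_prop (disch := assumption)) only [pd_div, pd_add,
    pd_mul, pd_const, pd_neg, pd_pow, pd_coord]
  simp only [if_true, one_ne_zero, zero_ne_one, if_false]
  push_cast
  field_simp
  ring

theorem integrable_round_curvature :
    Integrable fun z : Coord 2 => 8 / (1 + ‖z‖ ^ 2) ^ 2 := by
  refine integrable_of_decay (C := 8) ?_ fun z hz => ?_
  · exact Continuous.div (by fun_prop) (by fun_prop) fun z => by positivity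
  · rw [abs_of_nonneg (by positivity)]
    gcongr
    nlinarith [sq_nonneg ‖z‖]

section GaussBonnet

variable {G H : Coord 2 → Matrix (Fin 2) (Fin 2) ℝ}

theorem abs_pd_inversion_le {z : Coord 2} (hz : z ≠ 0) (i a : Fin 2) :
    |pd i (fun z => inversion z a) z| ≤ 3 / ‖z‖ ^ 2 := by
  have h0 := norm_pos_iff.2 hz
  rw [pd_inversion hz, ← norm_sq_coord, abs_div, abs_of_pos (by positivity : 0 < (‖z‖ ^ 2) ^ 2),
    div_le_div_iff₀ (by positivity) (by positivity)]
  have h1 : |z i * z a| ≤ ‖z‖ ^ 2 := by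
    rw [abs_mul, sq]
    exact mul_le_mul (abs_coord_le z i) (abs_coord_le z a) (abs_nonneg _) h0.le
  have h2 : |(if i = a then 1 else 0) * ‖z‖ ^ 2 - 2 * z i * z a| ≤ 3 * ‖z‖ ^ 2 := by
    have := abs_le.1 h1
    rw [abs_le]
    split_ifs <;> constructor <;> nlinarith
  calc _ ≤ 3 * ‖z‖ ^ 2 * ‖z‖ ^ 2 := by gcongr
    _ = _ := by ring

/-- The connection form and the form of the round sphere differ by `O(|z|⁻²)`. -/
theorem IsInversionPullback.exists_connForm_sub_roundForm_le (hG : IsPlaneMetric G)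
    (hH : IsPlaneMetric H) (h : IsInversionPullback G H) :
    ∃ C, ∀ i, ∀ z : Coord 2, 1 ≤ ‖z‖ → |connForm G i z - roundForm i z| ≤ C / ‖z‖ ^ 2 := by
  obtain ⟨C₀, hC₀, h0⟩ := exists_bound_comp_inversion (hH.contDiff_connForm 0).continuous
  obtain ⟨C₁, hC₁, h1⟩ := exists_bound_comp_inversion (hH.contDiff_connForm 1).continuous
  refine ⟨4 + 3 * C₀ + 3 * C₁, fun i z hz => ?_⟩
  have hz0 : z ≠ 0 := by rintro rfl; simp at hz; linarith
  have hN : (1 : ℝ) ≤ ‖z‖ ^ 2 := one_le_pow₀ hz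
  rw [h.connForm_eq hG hH hz0, roundForm, ← norm_sq_coord, Fin.sum_univ_two]
  set t : ℝ := if i = 0 then -z 1 else z 0 with ht
  have htz : |t| ≤ ‖z‖ := by
    rw [ht]
    split_ifs
    · rw [abs_neg]; exact abs_coord_le z 1
    · exact abs_coord_le z 0
  have e : 4 * t / ‖z‖ ^ 2 - 4 * t / (1 + ‖z‖ ^ 2) = 4 * (t / (1 + ‖z‖ ^ 2)) / ‖z‖ ^ 2 := by
    field_simp
    ring
  have e1 : |4 * t / ‖z‖ ^ 2 - 4 * t / (1 + ‖z‖ ^ 2)| ≤ 4 / ‖z‖ ^ 2 := by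
    rw [e, abs_div, abs_mul, abs_div, abs_of_pos (by positivity : 0 < ‖z‖ ^ 2),
      abs_of_pos (by positivity : 0 < 1 + ‖z‖ ^ 2), abs_of_pos (by norm_num : (0 : ℝ) < 4)]
    have : |t| / (1 + ‖z‖ ^ 2) ≤ 1 := by
      rw [div_le_one (by positivity)]
      nlinarith
    gcongr
    linarith
  have e2 : ∀ a C, |connForm H a (inversion z)| ≤ C →
      |pd i (fun z => inversion z a) z * connForm H a (inversion z)| ≤ 3 * C / ‖z‖ ^ 2 := by
    intro a C hC
    rw [abs_mul]
    calc _ ≤ 3 / ‖z‖ ^ 2 * C := by gcongr; exact abs_pd_inversion_le hz0 i a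
      _ = _ := by ring
  have e3 := e2 0 C₀ (h0 z hz)
  have e4 := e2 1 C₁ (h1 z hz)
  have e5 : (4 + 3 * C₀ + 3 * C₁) / ‖z‖ ^ 2 =
    4 / ‖z‖ ^ 2 + 3 * C₀ / ‖z‖ ^ 2 + 3 * C₁ / ‖z‖ ^ 2 := by ring
  rw [e5]
  rw [abs_le] at *
  constructor <;> linarith [e1.1, e1.2, e3.1, e3.2, e4.1, e4.2]

theorem continuous_curl_connForm (hG : IsPlaneMetric G) :
    Continuous fun z => pd 0 (connForm G 1) z - pd 1 (connForm G 0) z :=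
  (contDiff_pd 0 (hG.contDiff_connForm 1)).continuous.sub
    (contDiff_pd 1 (hG.contDiff_connForm 0)).continuous

theorem IsInversionPullback.integrable_curl (hG : IsPlaneMetric G)
    (hH : IsPlaneMetric H) (h : IsInversionPullback G H) :
    Integrable fun z => pd 0 (connForm G 1) z - pd 1 (connForm G 0) z := by
  obtain ⟨C, hC, h0⟩ := exists_bound_comp_inversion (continuous_curl_connForm hH)
  refine integrable_of_decay (continuous_curl_connForm hG) (C := C) fun z hz => ?_
  have hz0 : z ≠ 0 := by rintro rfl; simp at hz; linarith
  rw [h.curl_connForm_eq hG hH hz0, ← norm_sq_coord, abs_div, abs_of_nonneg (by positivity :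
    0 ≤ (‖z‖ ^ 2) ^ 2), ← pow_mul]
  gcongr
  exact h0 z hz

theorem IsInversionPullback.integrable_sqrt_det (hG : IsPlaneMetric G)
    (hH : IsPlaneMetric H) (h : IsInversionPullback G H) :
    Integrable fun z => √(G z).det := by
  obtain ⟨C, hC, h0⟩ := exists_bound_comp_inversion hH.continuous_sqrt_det
  refine integrable_of_decay hG.continuous_sqrt_det (C := C) fun z hz => ?_
  have hz0 : z ≠ 0 := by rintro rfl; simp at hz; linarith
  have h1 := h0 z hz
  rw [hH.det_eq] at h1
  rw [hG.det_eq, h.sqrt_det hG hH hz0, ← norm_sq_coord, abs_div, abs_of_nonneg (by positivity :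
    0 ≤ (‖z‖ ^ 2) ^ 2), ← pow_mul]
  gcongr

theorem IsInversionPullback.integrable_scalarCurv (hG : IsPlaneMetric G)
    (hH : IsPlaneMetric H) (h : IsInversionPullback G H) :
    Integrable fun z => scalarCurv G z * √(G z).det := by
  simp only [hG.scalarCurv_mul_sqrt_det]
  exact h.integrable_curl hG hH

/-- The Gauss–Bonnet theorem for a metric on the plane that extends smoothly to the sphere. -/
theorem IsInversionPullback.integral_scalarCurv (hG : IsPlaneMetric G)
    (hH : IsPlaneMetric H) (h : IsInversionPullback G H) :
    ∫ z, scalarCurv G z * √(G z).det = 8 * Real.pi := by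
  simp only [hG.scalarCurv_mul_sqrt_det]
  obtain ⟨C, hC⟩ := h.exists_connForm_sub_roundForm_le hG hH
  have hd : ∀ i z, DifferentiableAt ℝ (connForm G i) z := fun i z =>
    (hG.contDiff_connForm i).differentiable (by simp) z
  have hd' : ∀ i z, DifferentiableAt ℝ (roundForm i) z := fun i z =>
    (contDiff_roundForm i).differentiable (by simp) z
  have e : ∀ z, pd 0 (fun z => connForm G 1 z - roundForm 1 z) z
      - pd 1 (fun z => connForm G 0 z - roundForm 0 z) z =
      (pd 0 (connForm G 1) z - pd 1 (connForm G 0) z) - 8 / (1 + ‖z‖ ^ 2) ^ 2 := by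
    intro z
    rw [pd_sub 0 (hd 1 z) (hd' 1 z), pd_sub 1 (hd 0 z) (hd' 0 z), ← curl_roundForm]
    ring
  have hint := h.integrable_curl hG hH
  have key := integral_curl_eq_zero (p := fun i z => connForm G i z - roundForm i z)
    (fun i => (hG.contDiff_connForm i).sub (contDiff_roundForm i)) hC
    (by simp only [e]; exact hint.sub integrable_round_curvature)
  simp only [e] at key
  rw [integral_sub hint integrable_round_curvature, integral_round_curvature] at key
  linarith

end GaussBonnet

/-! ### Coefficients of a metric in local coordinates -/

section GramMatrix

variable {n : ℕ} {V : Type*} [AddCommGroup V] [Module ℝ V] [TopologicalSpace V]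

theorem gram_sum (B : V →L[ℝ] V →L[ℝ] ℝ) (T : Coord n →L[ℝ] V) (x y : Coord n) :
    B (T x) (T y) = ∑ i, ∑ j, x i * y j *
      B (T (EuclideanSpace.single i 1)) (T (EuclideanSpace.single j 1)) := by
  conv_lhs => rw [euclidean_eq_sum x, euclidean_eq_sum y]
  simp only [map_sum, map_smul, sum_apply, smul_apply,
    smul_eq_mul, Finset.mul_sum]
  rw [Finset.sum_comm]
  refine Finset.sum_congr rfl fun i _ => Finset.sum_congr rfl fun j _ => by ring

theorem posDef_gram (B : V →L[ℝ] V →L[ℝ] ℝ) (hs : ∀ v w, B v w = B w v)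
    (hp : ∀ v, v ≠ 0 → 0 < B v v) (T : Coord n →L[ℝ] V) (hT : Function.Injective T) :
    (Matrix.of fun i j : Fin n =>
      B (T (EuclideanSpace.single i 1)) (T (EuclideanSpace.single j 1))).PosDef := by
  refine Matrix.PosDef.of_dotProduct_mulVec_pos ?_ fun x hx => ?_
  · ext i j
    simp [hs]
  · have hx' : T (WithLp.toLp 2 x) ≠ 0 := by
      rw [Ne, map_eq_zero_iff T hT]
      simpa using hx
    have := hp _ hx'
    rw [gram_sum] at this
    simpa [dotProduct, Matrix.mulVec, Finset.mul_sum, mul_assoc, mul_comm, mul_left_comm] using this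

/-- The squared norm of a form `α`, computed with the inverse Gram matrix of a basis, equals `α g`
for the gradient `g` of `α`. -/
theorem exists_gradient (B : V →L[ℝ] V →L[ℝ] ℝ) (hs : ∀ v w, B v w = B w v)
    (hp : ∀ v, v ≠ 0 → 0 < B v v) (T : Coord n →L[ℝ] V) (hT : Function.Bijective T)
    (α : V →L[ℝ] ℝ) :
    ∃ g : V, (∀ v, B g v = α v) ∧
      ∑ k, ∑ l, (Matrix.of fun i j : Fin n =>
        B (T (EuclideanSpace.single i 1)) (T (EuclideanSpace.single j 1)))⁻¹ k l *
        α (T (EuclideanSpace.single k 1)) * α (T (EuclideanSpace.single l 1)) = α g := by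
  set A := Matrix.of fun i j : Fin n =>
    B (T (EuclideanSpace.single i 1)) (T (EuclideanSpace.single j 1)) with hA
  have hpd : A.PosDef := posDef_gram B hs hp T hT.1
  have hdet : IsUnit A.det := hpd.det_pos.ne'.isUnit
  set b : Fin n → ℝ := fun k => α (T (EuclideanSpace.single k 1)) with hb
  have hα : ∀ x, α (T x) = ∑ k, x k * b k := by
    intro x
    conv_lhs => rw [euclidean_eq_sum x]
    simp [hb]
  have hAb : A.mulVec (A⁻¹.mulVec b) = b := by
    rw [Matrix.mulVec_mulVec, Matrix.mul_nonsing_inv _ hdet, Matrix.one_mulVec]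
  refine ⟨T (WithLp.toLp 2 (A⁻¹.mulVec b)), fun v => ?_, ?_⟩
  · obtain ⟨x, rfl⟩ := hT.2 v
    rw [hs, gram_sum, hα]
    refine Finset.sum_congr rfl fun i _ => ?_
    rw [← congrFun hAb i, Matrix.mulVec, dotProduct, Finset.mul_sum]
    refine Finset.sum_congr rfl fun j _ => ?_
    simp only [hA, Matrix.of_apply]
    ring
  · rw [hα]
    simp only [Matrix.mulVec, dotProduct, Finset.sum_mul]
    refine Finset.sum_congr rfl fun i _ => Finset.sum_congr rfl fun j _ => ?_
    ring

end GramMatrix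

section Manifold

variable {M : Type*} [TopologicalSpace M] [ChartedSpace (Coord 3) M] [IsManifold (𝓡 3) ∞ M]
  (h : Metric3 M)

theorem metricCoeff_posDef {n : ℕ} {ψ : Coord n → M} {y : Coord n}
    (hψ : Function.Injective (mfderiv (𝓡 n) (𝓡 3) ψ y)) : (metricCoeff h ψ y).PosDef :=
  posDef_gram (V := TangentSpace (𝓡 3) (ψ y)) (h.inner (ψ y)) (h.symm _) (h.pos _)
    (mfderiv (𝓡 n) (𝓡 3) ψ y) hψ

theorem contDiffOn_metricCoeff {n : ℕ} {ψ : Coord n → M} {s : Set (Coord n)} (hs : IsOpen s)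
    (hψ : ContMDiffOn (𝓡 n) (𝓡 3) ∞ ψ s) (i j : Fin n) :
    ContDiffOn ℝ ∞ (fun y => metricCoeff h ψ y i j) s := by
  have hsec : ∀ v : Coord n, ContMDiffOn (𝓡 n) (𝓡 n).tangent ∞
      (fun y : Coord n => (⟨y, v⟩ : TangentBundle (𝓡 n) (Coord n))) s := by
    intro v y _
    exact contMDiffWithinAt_vectorSpace_iff_contDiffWithinAt.2 contDiffWithinAt_const
  have htan := hψ.contMDiffOn_tangentMapWithin (m := ∞) (by simp) hs.uniqueMDiffOn
  have hv : ∀ v : Coord n, ContMDiffOn (𝓡 n) (𝓡 3).tangent ∞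
      (fun y => Bundle.TotalSpace.mk' (Coord 3) (E := fun p : M => TangentSpace (𝓡 3) p)
        (ψ y) (mfderiv (𝓡 n) (𝓡 3) ψ y v)) s := by
    intro v
    refine (htan.comp (hsec v) fun y hy => hy).congr fun y hy => ?_
    simp only [Function.comp_def, tangentMapWithin]
    rw [mfderivWithin_of_mem_nhds (hs.mem_nhds hy)]
  have hg : ContMDiffOn (𝓡 n) ((𝓡 3).prod 𝓘(ℝ, Coord 3 →L[ℝ] Coord 3 →L[ℝ] ℝ)) ∞
      (fun y => Bundle.TotalSpace.mk' (Coord 3 →L[ℝ] Coord 3 →L[ℝ] ℝ)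
        (E := fun p : M => TangentSpace (𝓡 3) p →L[ℝ] TangentSpace (𝓡 3) p →L[ℝ] ℝ)
        (ψ y) (h.inner (ψ y))) s :=
    h.contMDiff.comp_contMDiffOn hψ
  have key := ContMDiffOn.clm_bundle_apply₂ (F₁ := Coord 3) (F₂ := Coord 3) (F₃ := ℝ)
    (E₃ := Bundle.Trivial M ℝ) hg (hv (EuclideanSpace.single i 1)) (hv (EuclideanSpace.single j 1))
  intro y hy
  have := key y hy
  simp only [Bundle.contMDiffWithinAt_totalSpace] at this
  exact this.2.contDiffWithinAt

theorem contDiff_metricCoeff {n : ℕ} {ψ : Coord n → M}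
    (hψ : ContMDiff (𝓡 n) (𝓡 3) ∞ ψ) (i j : Fin n) :
    ContDiff ℝ ∞ (fun y => metricCoeff h ψ y i j) :=
  contDiffOn_univ.1 (contDiffOn_metricCoeff h isOpen_univ hψ.contMDiffOn i j)

theorem metricCoeff_congr {n : ℕ} {ψ φ : Coord n → M} {y : Coord n} (hψ : ψ =ᶠ[𝓝 y] φ) :
    metricCoeff h ψ y = metricCoeff h φ y := by
  unfold metricCoeff
  rw [hψ.mfderiv_eq, hψ.eq_of_nhds]

theorem metricCoeff_comp {m n : ℕ} {ψ : Coord m → M} {w : Coord n → Coord m} {y : Coord n}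
    (hψ : MDifferentiableAt (𝓡 m) (𝓡 3) ψ (w y))
    (hw : ∀ a, DifferentiableAt ℝ (fun z => w z a) y) (i j : Fin n) :
    metricCoeff h (ψ ∘ w) y i j = ∑ a, ∑ b, pd i (fun z => w z a) y * pd j (fun z => w z b) y *
      metricCoeff h ψ (w y) a b := by
  have hw' : DifferentiableAt ℝ w y := differentiableAt_euclidean.2 hw
  have hT : ∀ i, mfderiv (𝓡 n) (𝓡 3) (ψ ∘ w) y (EuclideanSpace.single i (1 : ℝ)) =
      mfderiv (𝓡 m) (𝓡 3) ψ (w y) (fderiv ℝ w y (EuclideanSpace.single i 1)) := by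
    intro i
    have := mfderiv_comp_apply y hψ hw'.mdifferentiableAt (EuclideanSpace.single i (1 : ℝ))
    rwa [mfderiv_eq_fderiv] at this
  simp only [metricCoeff, Matrix.of_apply, hT, ← fderiv_single_apply _ hw]
  exact gram_sum (V := TangentSpace (𝓡 3) (ψ (w y))) (h.inner (ψ (w y)))
    (mfderiv (𝓡 m) (𝓡 3) ψ (w y)) _ _

omit [IsManifold (𝓡 3) ∞ M] in
theorem pd_comp_manifold {n : ℕ} {ρ : M → ℝ} {ψ : Coord n → M} {y : Coord n}
    (hρ : MDifferentiableAt (𝓡 3) 𝓘(ℝ, ℝ) ρ (ψ y)) (hψ : MDifferentiableAt (𝓡 n) (𝓡 3) ψ y)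
    (i : Fin n) : pd i (ρ ∘ ψ) y =
      mfderiv (𝓡 3) 𝓘(ℝ, ℝ) ρ (ψ y)
        (mfderiv (𝓡 n) (𝓡 3) ψ y (EuclideanSpace.single i (1 : ℝ))) := by
  have := mfderiv_comp_apply y hρ hψ (EuclideanSpace.single i (1 : ℝ))
  rw [mfderiv_eq_fderiv] at this
  exact this

end Manifold

/-! ### The lapse -/

section Lapse

variable {M : Type*} [TopologicalSpace M] [ChartedSpace (Coord 3) M] [IsManifold (𝓡 3) ∞ M]
  (h : Metric3 M) {ρ : M → ℝ}

/-- The squared norm `G^{kl} ∂_k f ∂_l f` of the differential of `f`, in local coordinates. -/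
def gradSq {n : ℕ} (G : Coord n → Matrix (Fin n) (Fin n) ℝ) (f : Coord n → ℝ) (y : Coord n) : ℝ :=
  ∑ k, ∑ l, (G y)⁻¹ k l * pd k f y * pd l f y

theorem lapseCoord_eq {n : ℕ} (G : Coord n → Matrix (Fin n) (Fin n) ℝ) (f : Coord n → ℝ)
    (y : Coord n) : lapseCoord G f y = (√(gradSq G f y))⁻¹ := by
  have : ∑ i, normalVec G f i y * pd i f y = gradSq G f y / √(gradSq G f y) := by
    simp only [normalVec, normalForm, Finset.sum_mul]
    rw [gradSq, Finset.sum_div]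
    refine Finset.sum_congr rfl fun i _ => ?_
    rw [Finset.sum_div]
    refine Finset.sum_congr rfl fun j _ => ?_
    ring
  rw [lapseCoord, this, Real.div_sqrt]

/-- In coordinates `ψ`, the squared norm of `dρ` is `dρ g` for a gradient `g` of `ρ`. -/
theorem exists_gradSq_eq {ψ : Coord 3 → M} {y : Coord 3}
    (hψ : Function.Bijective (mfderiv (𝓡 3) (𝓡 3) ψ y))
    (hρ : MDifferentiableAt (𝓡 3) 𝓘(ℝ, ℝ) ρ (ψ y)) :
    ∃ g : TangentSpace (𝓡 3) (ψ y),
      (∀ v, h.inner (ψ y) g v = mfderiv (𝓡 3) 𝓘(ℝ, ℝ) ρ (ψ y) v) ∧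
      gradSq (metricCoeff h ψ) (ρ ∘ ψ) y = mfderiv (𝓡 3) 𝓘(ℝ, ℝ) ρ (ψ y) g := by
  have hd : MDifferentiableAt (𝓡 3) (𝓡 3) ψ y := mdifferentiableAt_of_mfderiv_injective hψ.1
  obtain ⟨g, hg, hQ⟩ := exists_gradient (V := TangentSpace (𝓡 3) (ψ y)) (h.inner (ψ y)) (h.symm _)
    (h.pos _) (mfderiv (𝓡 3) (𝓡 3) ψ y) hψ (mfderiv (𝓡 3) 𝓘(ℝ, ℝ) ρ (ψ y))
  refine ⟨g, hg, Eq.trans ?_ hQ⟩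
  simp only [gradSq, pd_comp_manifold hρ hd]
  rfl

theorem gradient_unique {p : M} {g g' : TangentSpace (𝓡 3) p}
    (hg : ∀ v, h.inner p g v = h.inner p g' v) : g = g' := by
  by_contra hne
  have := h.pos p (g - g') (sub_ne_zero.2 hne)
  rw [map_sub (h.inner p) g g', sub_apply, hg, sub_self] at this
  exact lt_irrefl _ this

theorem bijective_mfderiv_chart_symm (p₀ : M) {y : Coord 3}
    (hy : y ∈ (chartAt (Coord 3) p₀).target) :
    Function.Bijective (mfderiv (𝓡 3) (𝓡 3) (chartAt (Coord 3) p₀).symm y) :=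
  haveI : IsManifold (𝓡 3) 1 M := .of_le (n := ∞) (by simp)
  (mdifferentiable_chart (I := 𝓡 3) p₀).symm.mfderiv_bijective hy

theorem exists_gradSq_chart_eq (hρ : ContMDiff (𝓡 3) 𝓘(ℝ, ℝ) ∞ ρ) (p₀ : M) {p : M}
    (hp : p ∈ (chartAt (Coord 3) p₀).source) : ∃ g : TangentSpace (𝓡 3) p,
      (∀ v, h.inner p g v = mfderiv (𝓡 3) 𝓘(ℝ, ℝ) ρ p v) ∧
      gradSq (metricCoeff h (chartAt (Coord 3) p₀).symm)
        (ρ ∘ (chartAt (Coord 3) p₀).symm) (chartAt (Coord 3) p₀ p) =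
        mfderiv (𝓡 3) 𝓘(ℝ, ℝ) ρ p g := by
  have := exists_gradSq_eq h (bijective_mfderiv_chart_symm p₀
    ((chartAt (Coord 3) p₀).map_source hp)) (hρ.mdifferentiable (by simp) _)
  rwa [(chartAt (Coord 3) p₀).left_inv hp] at this

/-- The lapse is `|dρ|⁻¹`, computed in any of the charts around the point. -/
theorem lapse_eq_of_mem_chart_source (hρ : ContMDiff (𝓡 3) 𝓘(ℝ, ℝ) ∞ ρ) (p₀ : M) {p : M}
    (hp : p ∈ (chartAt (Coord 3) p₀).source) :
    lapse h ρ p = (√(gradSq (metricCoeff h (chartAt (Coord 3) p₀).symm)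
      (ρ ∘ (chartAt (Coord 3) p₀).symm) (chartAt (Coord 3) p₀ p)))⁻¹ := by
  rw [lapse, lapseCoord_eq]
  obtain ⟨g, hg, e⟩  := exists_gradSq_chart_eq h hρ p (mem_chart_source _ p)
  obtain ⟨g', hg', e'⟩  := exists_gradSq_chart_eq h hρ p₀ hp
  rw [e, e', gradient_unique h fun v => (hg v).trans (hg' v).symm]

theorem gradSq_nonneg {n : ℕ} {G : Coord n → Matrix (Fin n) (Fin n) ℝ} (f : Coord n → ℝ)
    {y : Coord n} (hG : (G y).PosDef) : 0 ≤ gradSq G f y := by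
  have := hG.inv.posSemidef.dotProduct_mulVec_nonneg (fun i => pd i f y)
  simpa [gradSq, dotProduct, Matrix.mulVec, Finset.mul_sum, mul_assoc, mul_comm, mul_left_comm]
    using this

theorem lapse_ne_zero (hρ : ContMDiff (𝓡 3) 𝓘(ℝ, ℝ) ∞ ρ) {p : M}
    (hp : mfderiv (𝓡 3) 𝓘(ℝ, ℝ) ρ p ≠ 0) : lapse h ρ p ≠ 0 := by
  obtain ⟨g, hg, e⟩ := exists_gradSq_chart_eq h hρ p (mem_chart_source _ p)
  rw [lapse, lapseCoord_eq, e, ← hg]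
  have hg0 : g ≠ 0 := by
    rintro rfl
    apply hp
    ext v
    exact (hg v).symm.trans (by simp; rfl)
  exact inv_ne_zero (Real.sqrt_pos.2 (h.pos _ g hg0)).ne'

/-- `N⁻² = |dρ|²` is continuous, although the chart in which `lapse` is computed jumps from point to
point: around a given point, it may be computed in one chart. -/
theorem continuous_inv_sq_lapse (hρ : ContMDiff (𝓡 3) 𝓘(ℝ, ℝ) ∞ ρ) :
    Continuous fun p => (lapse h ρ p ^ 2)⁻¹ := by
  rw [continuous_iff_continuousAt]
  intro p₀
  set e := chartAt (Coord 3) p₀ with he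
  have hs : e.source ∈ 𝓝 p₀ := e.open_source.mem_nhds (mem_chart_source _ p₀)
  have hpos : ∀ y ∈ e.target, (metricCoeff h e.symm y).PosDef := fun y hy =>
    metricCoeff_posDef h (bijective_mfderiv_chart_symm p₀ hy).1
  have hsm : ContMDiffOn (𝓡 3) (𝓡 3) ∞ e.symm e.target := contMDiffOn_chart_symm
  have hG : ContinuousOn (metricCoeff h e.symm) e.target :=
    continuousOn_pi.2 fun i => continuousOn_pi.2 fun j =>
      (contDiffOn_metricCoeff h e.open_target hsm i j).continuousOn
  have hf : ContDiffOn ℝ ∞ (ρ ∘ e.symm) e.target :=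
    contMDiffOn_iff_contDiffOn.1 (hρ.comp_contMDiffOn hsm)
  have hpd : ∀ k, ContinuousOn (pd k (ρ ∘ e.symm)) e.target := fun k =>
    (hf.continuousOn_fderiv_of_isOpen e.open_target (by simp)).clm_apply continuousOn_const
  have hinv : ContinuousOn (fun y => (metricCoeff h e.symm y)⁻¹) e.target := by
    simp only [Matrix.inv_def, Ring.inverse_eq_inv']
    refine ContinuousOn.smul (ContinuousOn.inv₀ ?_ fun y hy => (hpos y hy).det_pos.ne') ?_
    · exact (continuous_id.matrix_det).comp_continuousOn hG
    · exact (continuous_id.matrix_adjugate).comp_continuousOn hG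
  have hQ : ContinuousOn (gradSq (metricCoeff h e.symm) (ρ ∘ e.symm)) e.target := by
    refine continuousOn_finsetSum _ fun k _ => continuousOn_finsetSum _ fun l _ => ?_
    refine ((?_ : ContinuousOn _ _).mul (hpd k)).mul (hpd l)
    exact continuousOn_pi.1 (continuousOn_pi.1 hinv k) l
  have hcomp : ContinuousAt (fun p => gradSq (metricCoeff h e.symm) (ρ ∘ e.symm) (e p)) p₀ :=
    ContinuousAt.comp (g := gradSq (metricCoeff h e.symm) (ρ ∘ e.symm))
      (hQ.continuousAt (e.open_target.mem_nhds (e.map_source (mem_chart_source _ p₀))))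
      (e.continuousAt (mem_chart_source _ p₀))
  refine hcomp.congr ?_
  filter_upwards [hs] with p hp
  rw [lapse_eq_of_mem_chart_source h hρ p₀ hp, inv_pow, inv_inv,
    Real.sq_sqrt (gradSq_nonneg _ (hpos _ (e.map_source hp)))]

end Lapse

/-! ### Stereographic coordinates on the sphere -/

section Stereographic

theorem inversion_inversion {z : Coord 2} (hz : z ≠ 0) : inversion (inversion z) = z := by
  have h0 := (sq_add_sq_pos hz).ne'
  ext a
  simp only [inversion_apply]
  field_simp

theorem inversion_ne_zero {z : Coord 2} (hz : z ≠ 0) : inversion z ≠ 0 := by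
  have h0 := (sq_add_sq_pos hz).ne'
  simp [inversion, hz, h0]

/-- The stereographic coordinates from antipodal points are related by the inversion, up to a
linear map, which depends on the choice of orthonormal bases. -/
theorem exists_stereoInv_neg_eq (v : Sphere2) : ∃ L : Coord 2 ≃L[ℝ] Coord 2, ∀ w ≠ 0,
    stereoInv (-v) (L w) = stereoInv v (inversion w) := by
  let U := (OrthonormalBasis.fromOrthogonalSpanSingleton (𝕜 := ℝ) 2
    (ne_zero_of_mem_unit_sphere v)).repr
  let U' := (OrthonormalBasis.fromOrthogonalSpanSingleton (𝕜 := ℝ) 2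
    (ne_zero_of_mem_unit_sphere (-v))).repr
  have hsub : (Submodule.span ℝ {(v : Coord 3)})ᗮ =
      (Submodule.span ℝ {((-v : Sphere2) : Coord 3)})ᗮ := by
    rw [← Submodule.span_neg]
    simp
  let O : Coord 2 ≃ₗᵢ[ℝ] Coord 2 := (U.symm.trans (LinearIsometryEquiv.ofEq _ _ hsub)).trans U'
  -- The factor `4` arises as Mathlib projects onto the tangent plane at the antipodal point.
  let four : Coord 2 ≃L[ℝ] Coord 2 :=
    ContinuousLinearEquiv.smulLeft (Units.mk0 (4 : ℝ) four_ne_zero)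
  refine ⟨four.trans O.toContinuousLinearEquiv, fun w hw => ?_⟩
  have hL : ((four.trans O.toContinuousLinearEquiv) w) = O ((4 : ℝ) • w) := rfl
  have hO : ∀ x, ((U'.symm (O x) : _) : Coord 3) = (U.symm x : _) := by
    intro x
    have : U'.symm (O x) = LinearIsometryEquiv.ofEq _ _ hsub (U.symm x) :=
      U'.symm_apply_apply _
    rw [this]
    rfl
  have hn : (0 : ℝ) < ‖w‖ ^ 2 := by positivity
  apply Subtype.ext
  rw [hL, stereoInv, stereoInv, stereographic'_symm_apply, stereographic'_symm_apply]
  change (‖((U'.symm (O ((4 : ℝ) • w)) : _) : Coord 3)‖ ^ 2 + 4)⁻¹ • (4 : ℝ) •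
      ((U'.symm (O ((4 : ℝ) • w)) : _) : Coord 3) +
    (‖((U'.symm (O ((4 : ℝ) • w)) : _) : Coord 3)‖ ^ 2 + 4)⁻¹ •
      (‖((U'.symm (O ((4 : ℝ) • w)) : _) : Coord 3)‖ ^ 2 - 4) • ((-v : Sphere2) : Coord 3) =
    (‖((U.symm (inversion w) : _) : Coord 3)‖ ^ 2 + 4)⁻¹ • (4 : ℝ) •
      ((U.symm (inversion w) : _) : Coord 3) +
    (‖((U.symm (inversion w) : _) : Coord 3)‖ ^ 2 + 4)⁻¹ •
      (‖((U.symm (inversion w) : _) : Coord 3)‖ ^ 2 - 4) • (v : Coord 3)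
  obtain ⟨u, hu⟩ : ∃ u : Coord 3, u = (U.symm w : _) := ⟨_, rfl⟩
  have hun : ‖u‖ = ‖w‖ := by
    rw [hu, ← Submodule.coe_norm, LinearIsometryEquiv.norm_map]
  have hsm : ∀ c : ℝ, ((U.symm (c • w) : _) : Coord 3) = c • u := by
    intro c
    rw [hu, map_smul, Submodule.coe_smul]
  have hneg : ((-v : Sphere2) : Coord 3) = -(v : Coord 3) := rfl
  rw [hO, inversion, ← norm_sq_coord, hsm, hsm, norm_smul, norm_smul, hun, hneg,
    Real.norm_of_nonneg four_pos.le, Real.norm_of_nonneg (inv_nonneg.2 hn.le)]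
  match_scalars
  · field_simp
    ring
  · field_simp
    ring

theorem contMDiff_stereoInv (v : Sphere2) : ContMDiff (𝓡 2) (𝓡 2) ∞ (stereoInv v) := by
  have hm : stereographic' 2 v ∈ atlas (Coord 2) Sphere2 := ⟨v, rfl⟩
  have := contMDiffOn_symm_of_mem_maximalAtlas (I := 𝓡 2) (n := ∞)
    (IsManifold.subset_maximalAtlas hm)
  rw [stereographic'_target] at this
  exact contMDiffOn_univ.1 this

theorem injective_mfderiv_stereoInv (v : Sphere2) (y : Coord 2) :
    Function.Injective (mfderiv (𝓡 2) (𝓡 2) (stereoInv v) y) := by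
  have hm : stereographic' 2 v ∈ atlas (Coord 2) Sphere2 := ⟨v, rfl⟩
  have : IsManifold (𝓡 2) 1 Sphere2 := .of_le (n := ω) (by simp)
  exact (mdifferentiable_of_mem_atlas (I := 𝓡 2) hm).symm.mfderiv_injective (by simp)

theorem isOpenEmbedding_stereoInv (v : Sphere2) : Topology.IsOpenEmbedding (stereoInv v) :=
  (stereographic' 2 v).symm.isOpenEmbedding (by simp)

theorem stereoInv_ne (v : Sphere2) (y : Coord 2) : stereoInv v y ≠ v := by
  have := (stereographic' 2 v).map_target (x := y) (by simp)
  simpa [stereoInv] using this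

theorem stereographic_stereoInv (v : Sphere2) (y : Coord 2) :
    stereographic' 2 v (stereoInv v y) = y :=
  (stereographic' 2 v).right_inv (by simp)

end Stereographic

section Leaf

variable {M : Type*} [TopologicalSpace M] [ChartedSpace (Coord 3) M] [IsManifold (𝓡 3) ∞ M]
  (h : Metric3 M) {f : Sphere2 → M}

theorem isPlaneMetric_metricCoeff {ψ : Coord 2 → M} (hψ : ContMDiff (𝓡 2) (𝓡 3) ∞ ψ)
    (hi : ∀ y, Function.Injective (mfderiv (𝓡 2) (𝓡 3) ψ y)) :
    IsPlaneMetric (metricCoeff h ψ) :=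
  ⟨contDiff_metricCoeff h hψ, fun y => metricCoeff_posDef h (hi y)⟩

omit [IsManifold (𝓡 3) ∞ M] in
theorem injective_mfderiv_comp_equiv {n : ℕ} {ψ : Coord n → M} {L : Coord n ≃L[ℝ] Coord n}
    {y : Coord n} (hψ : MDifferentiableAt (𝓡 n) (𝓡 3) ψ (L y))
    (hi : Function.Injective (mfderiv (𝓡 n) (𝓡 3) ψ (L y))) :
    Function.Injective (mfderiv (𝓡 n) (𝓡 3) (ψ ∘ L) y) := by
  intro a b hab
  have e := mfderiv_comp_apply y hψ (L.differentiableAt (x := y)).mdifferentiableAt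
  have h1 := hi ((e a).symm.trans (hab.trans (e b)))
  have h2 : mfderiv (𝓡 n) (𝓡 n) L y = (L : Coord n →L[ℝ] Coord n) := by
    rw [mfderiv_eq_fderiv, L.fderiv]
  rw [h2] at h1
  exact L.injective h1

/-- The metric that a smooth immersion of the sphere induces in stereographic coordinates extends
smoothly to the point at infinity. -/
theorem exists_isInversionPullback (hf : ContMDiff (𝓡 2) (𝓡 3) ∞ f)
    (hi : ∀ x, Function.Injective (mfderiv (𝓡 2) (𝓡 3) f x)) (v : Sphere2) :
    IsPlaneMetric (metricCoeff h (f ∘ stereoInv v)) ∧ ∃ H, IsPlaneMetric H ∧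
      IsInversionPullback (metricCoeff h (f ∘ stereoInv v)) H := by
  obtain ⟨L, hL⟩ := exists_stereoInv_neg_eq v
  have hf1 : MDifferentiable (𝓡 2) (𝓡 3) f := hf.mdifferentiable (by simp)
  have hs := contMDiff_stereoInv
  have hs1 : ∀ v, MDifferentiable (𝓡 2) (𝓡 2) (stereoInv v) := fun v =>
    (hs v).mdifferentiable (by simp)
  have hfs : ∀ v, ContMDiff (𝓡 2) (𝓡 3) ∞ (f ∘ stereoInv v) := fun v => hf.comp (hs v)
  have hfs1 : ∀ v, MDifferentiable (𝓡 2) (𝓡 3) (f ∘ stereoInv v) := fun v =>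
    (hfs v).mdifferentiable (by simp)
  have hinj : ∀ v y, Function.Injective (mfderiv (𝓡 2) (𝓡 3) (f ∘ stereoInv v) y) := by
    intro v y
    rw [mfderiv_comp y (hf1 _) (hs1 v _)]
    exact (hi _).comp (injective_mfderiv_stereoInv v y)
  have hLs : ContMDiff (𝓡 2) (𝓡 2) ∞ L := L.contDiff.contMDiff
  have hLd : ∀ y, MDifferentiableAt (𝓡 2) (𝓡 2) L y := fun y =>
    L.differentiableAt.mdifferentiableAt
  refine ⟨isPlaneMetric_metricCoeff h (hfs v) (hinj v),
    metricCoeff h ((f ∘ stereoInv (-v)) ∘ L),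
    isPlaneMetric_metricCoeff h ((hfs (-v)).comp hLs) fun y => ?_, fun z hz i j => ?_⟩
  · exact injective_mfderiv_comp_equiv (hfs1 _ _) (hinj _ _)
  · have he : f ∘ stereoInv v =ᶠ[𝓝 z] ((f ∘ stereoInv (-v)) ∘ L) ∘ inversion := by
      filter_upwards [isOpen_ne.mem_nhds hz] with y hy
      simp only [Function.comp_apply]
      rw [hL _ (inversion_ne_zero hy), inversion_inversion hy]
    rw [metricCoeff_congr h he, metricCoeff_comp h _ (differentiableAt_inversion hz)]
    exact (hfs1 _ _).comp _ (hLd _)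

end Leaf

/-! ### The geometry of a leaf -/

/-- The derivative of the area radius in terms of the logarithmic derivative of the area. If `A`
is not differentiable, neither are `log A` and `√A`, and both sides are zero. -/
theorem deriv_sqrt_div_eq {A : ℝ → ℝ} {r c : ℝ} (hc : 0 < c) (hA : ∀ᶠ s in 𝓝 r, 0 < A s) :
    deriv (fun s => √(A s / c)) r = √(A r / c) / 2 * deriv (fun s => Real.log (A s)) r := by
  have hlog : (fun s => Real.log (√(A s / c))) =ᶠ[𝓝 r]
      fun s => (Real.log (A s) - Real.log c) / 2 := by
    filter_upwards [hA] with s hs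
    rw [Real.log_sqrt (by positivity), Real.log_div hs.ne' hc.ne']
  have hexp : (fun s => √(A s / c)) =ᶠ[𝓝 r]
      fun s => Real.exp ((Real.log (A s) - Real.log c) / 2) := by
    filter_upwards [hA, hlog] with s hs hs'
    rw [← hs', Real.exp_log (Real.sqrt_pos.2 (by positivity))]
  by_cases hd : DifferentiableAt ℝ (fun s => Real.log (A s)) r
  · have h1 := ((hd.hasDerivAt.sub_const (Real.log c)).div_const 2).exp
    have h2 : √(A r / c) = _ := hexp.self_of_nhds
    rw [hexp.deriv_eq, h1.deriv, h2]
    ring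
  · have hd' : ¬ DifferentiableAt ℝ (fun s => √(A s / c)) r := by
      intro h
      apply hd
      have hne : √(A r / c) ≠ 0 := (Real.sqrt_pos.2 (div_pos hA.self_of_nhds hc)).ne'
      have h2 := (((h.log hne).congr_of_eventuallyEq hlog.symm).const_mul 2).add_const (Real.log c)
      refine h2.congr_of_eventuallyEq (Eventually.of_forall fun s => ?_)
      ring
    rw [deriv_zero_of_not_differentiableAt hd, deriv_zero_of_not_differentiableAt hd', mul_zero]

namespace SphereFoliation

variable {M : Type*} [TopologicalSpace M] [ChartedSpace (Coord 3) M] [IsManifold (𝓡 3) ∞ M]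
  {ρ : M → ℝ} (F : SphereFoliation ρ) (h : Metric3 M) {r : ℝ} (hr : r ∈ F.params)

include hr

omit [IsManifold (𝓡 3) ∞ M] in
theorem contMDiff_leaf : ContMDiff (𝓡 2) (𝓡 3) ∞ (F.leaf r) := by
  have h1 : ContMDiff (𝓡 2) (𝓘(ℝ, ℝ).prod (𝓡 2)) ∞ (fun x : Sphere2 => (r, x)) :=
    contMDiff_const.prodMk contMDiff_id
  exact F.smooth_leaf.comp_contMDiff h1 fun x => ⟨hr, Set.mem_univ x⟩

omit [IsManifold (𝓡 3) ∞ M] in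
theorem ρ_leaf (x : Sphere2) : ρ (F.leaf r x) = r := by
  have : F.leaf r x ∈ ρ ⁻¹' {r} := F.range_leaf r hr ▸ Set.mem_range_self x
  exact this

omit [IsManifold (𝓡 3) ∞ M] in
/-- As `ρ` increases with unit speed along the flow, it has no critical point on a leaf. -/
theorem mfderiv_leaf_ne_zero (x : Sphere2) : mfderiv (𝓡 3) 𝓘(ℝ, ℝ) ρ (F.leaf r x) ≠ 0 := by
  intro h0
  have hn : F.params ∈ 𝓝 r := F.isOpen_params.mem_nhds hr
  have h1 : ContMDiff 𝓘(ℝ, ℝ) (𝓘(ℝ, ℝ).prod (𝓡 2)) ∞ (fun s : ℝ => (s, x)) :=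
    contMDiff_id.prodMk contMDiff_const
  have hc : ContMDiffOn 𝓘(ℝ, ℝ) (𝓡 3) ∞ (fun s => F.leaf s x) F.params :=
    F.smooth_leaf.comp h1.contMDiffOn fun s hs => ⟨hs, Set.mem_univ x⟩
  have hc1 : MDifferentiableAt 𝓘(ℝ, ℝ) (𝓡 3) (fun s => F.leaf s x) r :=
    ((hc r hr).mdifferentiableWithinAt (by simp)).mdifferentiableAt hn
  have hρ : MDifferentiableAt (𝓡 3) 𝓘(ℝ, ℝ) ρ (F.leaf r x) :=
    F.smooth_ρ.mdifferentiable (by simp) _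
  have hcomp := mfderiv_comp_apply r hρ hc1 (1 : ℝ)
  have he : ρ ∘ (fun s => F.leaf s x) =ᶠ[𝓝 r] fun s => s := by
    filter_upwards [hn] with s hs
    exact F.ρ_leaf hs x
  rw [h0, mfderiv_eq_fderiv, he.fderiv_eq] at hcomp
  simp only [fderiv_fun_id] at hcomp
  exact one_ne_zero (α := ℝ) hcomp

theorem exists_isInversionPullback_leafMetric :
    IsPlaneMetric (F.leafMetric h r northPole) ∧ ∃ H, IsPlaneMetric H ∧
      IsInversionPullback (F.leafMetric h r northPole) H :=
  exists_isInversionPullback h (F.contMDiff_leaf hr) (F.immersion_leaf r hr) northPole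

theorem isPlaneMetric_leafMetric : IsPlaneMetric (F.leafMetric h r northPole) :=
  (F.exists_isInversionPullback_leafMetric h hr).1

theorem measurable_areaDensity :
    Measurable fun y => ENNReal.ofReal √(F.leafMetric h r northPole y).det :=
  ((F.isPlaneMetric_leafMetric h hr).continuous_sqrt_det.measurable).ennreal_ofReal

theorem integral_area (g : Sphere2 → ℝ) : ∫ x, g x ∂(F.area h r) =
    ∫ y, g (stereoInv northPole y) * √(F.leafMetric h r northPole y).det := by
  rw [area, (isOpenEmbedding_stereoInv northPole).measurableEmbedding.integral_map,
    integral_withDensity_eq_integral_toReal_smul (F.measurable_areaDensity h hr)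
      (Eventually.of_forall fun _ => ENNReal.ofReal_lt_top)]
  refine integral_congr_ae (Eventually.of_forall fun y => ?_)
  simp [ENNReal.toReal_ofReal (Real.sqrt_nonneg _), mul_comm]

theorem integrable_area_iff (g : Sphere2 → ℝ) : Integrable g (F.area h r) ↔
    Integrable fun y => g (stereoInv northPole y) * √(F.leafMetric h r northPole y).det := by
  rw [area, (isOpenEmbedding_stereoInv northPole).measurableEmbedding.integrable_map_iff,
    integrable_withDensity_iff_integrable_smul' (F.measurable_areaDensity h hr)
      (Eventually.of_forall fun _ => ENNReal.ofReal_lt_top)]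
  refine integrable_congr (Eventually.of_forall fun y => ?_)
  simp [ENNReal.toReal_ofReal (Real.sqrt_nonneg _), mul_comm]

theorem isFiniteMeasure_area : IsFiniteMeasure (F.area h r) := by
  have h1 : Integrable (fun _ : Sphere2 => (1 : ℝ)) (F.area h r) := by
    obtain ⟨hG, H, hH, hGH⟩ := F.exists_isInversionPullback_leafMetric h hr
    rw [F.integrable_area_iff h hr]
    simpa using hGH.integrable_sqrt_det hG hH
  simpa [integrable_const_iff] using h1

theorem totalArea_pos : 0 < F.totalArea h r := by
  have := F.isFiniteMeasure_area h hr
  obtain ⟨hG, H, hH, hGH⟩ := F.exists_isInversionPullback_leafMetric h hr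
  have h1 : F.totalArea h r = ∫ _, (1 : ℝ) ∂(F.area h r) := by simp [totalArea]
  rw [h1, F.integral_area h hr]
  simp only [one_mul]
  rw [integral_pos_iff_support_of_nonneg (fun _ => Real.sqrt_nonneg _)
    (hGH.integrable_sqrt_det hG hH)]
  have : (Function.support fun y => √(F.leafMetric h r northPole y).det) = Set.univ := by
    ext y
    simpa using (Real.sqrt_pos.2 (hG.posDef y).det_pos).ne'
  rw [this]
  simp

omit hr in
theorem leafScalarCurv_stereoInv (y : Coord 2) :
    F.leafScalarCurv h r (stereoInv northPole y) = scalarCurv (F.leafMetric h r northPole) y := by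
  simp only [leafScalarCurv, if_neg (stereoInv_ne northPole y), stereographic_stereoInv]

theorem integrable_leafScalarCurv : Integrable (F.leafScalarCurv h r) (F.area h r) := by
  obtain ⟨hG, H, hH, hGH⟩ := F.exists_isInversionPullback_leafMetric h hr
  rw [F.integrable_area_iff h hr]
  simp only [leafScalarCurv_stereoInv]
  exact hGH.integrable_scalarCurv hG hH

/-- The Gauss–Bonnet theorem for a leaf. -/
theorem integral_leafScalarCurv : ∫ x, F.leafScalarCurv h r x ∂(F.area h r) = 8 * Real.pi := by
  obtain ⟨hG, H, hH, hGH⟩ := F.exists_isInversionPullback_leafMetric h hr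
  rw [F.integral_area h hr]
  simp only [leafScalarCurv_stereoInv]
  exact hGH.integral_scalarCurv hG hH

theorem integrable_inv_sq_lapse :
    Integrable (fun x => (lapse h ρ (F.leaf r x) ^ 2)⁻¹) (F.area h r) := by
  have := F.isFiniteMeasure_area h hr
  have hc : Continuous fun x => (lapse h ρ (F.leaf r x) ^ 2)⁻¹ :=
    (continuous_inv_sq_lapse h F.smooth_ρ).comp (F.contMDiff_leaf hr).continuous
  exact hc.integrable_of_hasCompactSupport (HasCompactSupport.of_compactSpace _)

theorem meanCurv_sq_eq (hshift : F.ShiftCondition h) (x : Sphere2) :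
    meanCurv h ρ (F.leaf r x) ^ 2 =
      deriv (fun s => Real.log (F.totalArea h s)) r ^ 2 * (lapse h ρ (F.leaf r x) ^ 2)⁻¹ := by
  have h0 := lapse_ne_zero h F.smooth_ρ (F.mfderiv_leaf_ne_zero hr x)
  have := (hshift r hr x).1.trans (hshift r hr x).2
  rw [← this]
  field_simp

theorem gerochMass_eq (hshift : F.ShiftCondition h) :
    F.gerochMass h r = √(F.totalArea h r) / (64 * Real.pi ^ (3 / 2 : ℝ)) *
      (16 * Real.pi - ∫ x, deriv (fun s => Real.log (F.totalArea h s)) r ^ 2 *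
        (lapse h ρ (F.leaf r x) ^ 2)⁻¹ ∂(F.area h r)) := by
  rw [gerochMass]
  simp only [F.meanCurv_sq_eq h hr hshift]
  rw [integral_sub ((F.integrable_leafScalarCurv h hr).const_mul 2)
    ((F.integrable_inv_sq_lapse h hr).const_mul _), integral_const_mul,
    F.integral_leafScalarCurv h hr]
  ring

theorem lapseAreaIntegral_eq : F.lapseAreaIntegral h r = 4 * Real.pi - 1 / 4 *
    ∫ x, deriv (fun s => Real.log (F.totalArea h s)) r ^ 2 *
        (lapse h ρ (F.leaf r x) ^ 2)⁻¹ ∂(F.area h r) := by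
  have := F.isFiniteMeasure_area h hr
  have hA := F.totalArea_pos h hr
  have hev : ∀ᶠ s in 𝓝 r, 0 < F.totalArea h s := by
    filter_upwards [F.isOpen_params.mem_nhds hr] with s hs
    exact F.totalArea_pos h hs
  have hpi := Real.pi_pos
  rw [lapseAreaIntegral, normalizedArea, integral_smul_measure,
    deriv_sqrt_div_eq (by positivity) hev, integral_sub (integrable_const _)
    ((F.integrable_inv_sq_lapse h hr).const_mul _), integral_const_mul, integral_const_mul,
    ENNReal.toReal_ofReal (by positivity), mul_pow, div_pow, Real.sq_sqrt (by positivity)]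
  rw [integral_const, smul_eq_mul, smul_eq_mul, ← totalArea]
  field_simp
  ring

theorem normalizedArea_univ :
    F.normalizedArea h r Set.univ = ENNReal.ofReal (4 * Real.pi) := by
  have := F.isFiniteMeasure_area h hr
  have hA := F.totalArea_pos h hr
  have hpi := Real.pi_pos
  rw [normalizedArea, Measure.smul_apply, smul_eq_mul,
    ← ENNReal.ofReal_toReal (measure_ne_top (F.area h r) Set.univ), ← ENNReal.ofReal_mul
      (by positivity)]
  congr 1
  change (F.totalArea h r / (4 * Real.pi))⁻¹ * F.totalArea h r = _
  field_simp

end SphereFoliation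

end Geroch

end
theorem proposition2 {M : Type*} [TopologicalSpace M] [T2Space M] [SecondCountableTopology M]
    [ChartedSpace (Geroch.Coord 3) M] [IsManifold (𝓡 3) ∞ M]
    (h : Geroch.Metric3 M) (ρ : M → ℝ) (F : Geroch.SphereFoliation ρ)
    (hshift : F.ShiftCondition h) (r : ℝ) (hr : r ∈ F.params) :
    F.normalizedArea h r Set.univ = ENNReal.ofReal (4 * Real.pi) ∧
    F.gerochMass h r = √(F.totalArea h r) / (64 * Real.pi ^ (3 / 2 : ℝ)) *
      (16 * Real.pi - ∫ x, deriv (fun s => Real.log (F.totalArea h s)) r ^ 2 *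
        (Geroch.lapse h ρ (F.leaf r x) ^ 2)⁻¹ ∂(F.area h r)) ∧
    F.gerochMass h r = 1 / (8 * Real.pi) * √(F.totalArea h r / (4 * Real.pi)) *
      F.lapseAreaIntegral h r ∧
    (0 ≤ F.lapseAreaIntegral h r → 0 ≤ F.gerochMass h r) := by
  have hpi := Real.pi_pos
  have hmass := F.gerochMass_eq h hr hshift
  have hlapse : F.gerochMass h r = 1 / (8 * Real.pi) * √(F.totalArea h r / (4 * Real.pi)) *
      F.lapseAreaIntegral h r := by
    have hpow : Real.pi ^ (3 / 2 : ℝ) = Real.pi * √Real.pi := by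
      rw [Real.sqrt_eq_rpow, ← Real.rpow_one_add' hpi.le (by norm_num)]
      norm_num
    have h4 : √(4 : ℝ) = 2 := by
      rw [show (4 : ℝ) = 2 ^ 2 by norm_num, Real.sqrt_sq two_pos.le]
    rw [hmass, F.lapseAreaIntegral_eq h hr, hpow, Real.sqrt_div' _ (by positivity),
      Real.sqrt_mul four_pos.le, h4]
    field_simp
    ring
  refine ⟨F.normalizedArea_univ h hr, hmass, hlapse, fun h0 => ?_⟩
  rw [hlapse]
  positivity
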